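/- Let $Q$ be a commutative ring, $\boldsymbol f=f_1,\dots,f_n$ and $\boldsymbol f'=f_1',\dots,f_n'$ two lists of elements of $Q$, $I\subseteq Q$ an ideal containing all $f_i$ and $f_i'$, and $R=Q/I$. Let $E=Q\langle \xi_1,\dots,\xi_n\mid \partial\xi_i=f_i\rangle$ and $E'=Q\langle \xi'_1,\dots,\xi'_n\mid \partial\xi'_i=f'_i\rangle$ be the Koszul complexes and $\Lambda=E\otimes_Q E'$. Let $\mathcal P=R[\chi_1,\dots,\chi_n]$ be the polynomial ring with zero differential and each $\chi_i$ of homological degree $-2$, and let $\mathcal D=\operatorname{Hom}_R(\mathcal P,R)$ be its graded $R$-linear dual, with $(p\varphi)(q)=\varphi(pq)$. A DG module $P$ over a DG algebra $A$ is semiprojective if for every morphism $\alpha:P\to Y$ and every surjective quasi-isomorphism $\gamma:X\to Y$ of DG $A$-modules there is a morphism $\beta:P\to X$ with $\gamma\beta=\alpha$, unique up to homotopy; a semiprojective resolution of a DG $A$-module $M$ is a surjective quasi-isomorphism $P\to M$ of DG $A$-modules with $P$ semiprojective. Let $M$ be an $R$-module with $f_i-f'_i\in I\cdot\operatorname{ann}_Q(M)$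 for each $i$. A strong $\Lambda$-resolution of $M$ is obtained as follows: write $f_i-f'_i=\sum_j x_{i,j}g_{i,j}$ (finite sums) with $x_{i,j}\in I$ and $g_{i,j}\in\operatorname{ann}_Q(M)$, put $B=\Lambda\langle\zeta_{i,j}\mid\partial\zeta_{i,j}=g_{i,j}\rangle$ (exterior variables of degree $1$), regard $M$ as a DG $B$-module concentrated in degree $0$ on which all $\xi_i,\xi'_i,\zeta_{i,j}$ act as $0$, and take a bounded below semiprojective resolution $F\to M$ over $B$. Then for every strong $\Lambda$-resolution $F\to M$ (for any choice of the $x_{i,j},g_{i,j}$) there is an isomorphism of DG $\mathcal P\otimes_Q\Lambda$-modules $$(\mathcal D\otimes_Q F)^{\delta}\;\cong\;(\mathcal D\otimes_Q F)^{\varepsilon},\qquad \delta=\sum_{i=1}^n\chi_i\otimes\lambda_i,\quad \varepsilon=\sum_{i=1}^n\chi_i\otimes\lambda'_i,$$ where $\lambda_i$ and $\lambda'_i$ denote left multiplication by $\xi_i$ and $\xi'_i$ on $F$, and $X^{\delta}$ denotes the graded module $X$ with the differential $\partial^X+\delta$. -/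

import Mathlib

open scoped TensorProduct

universe u

noncomputable section

/-! ### Gradings -/

/-- A criterion for a family of submodules to be the pieces of a direct sum decomposition. -/
theorem isInternal_of_detect {Q : Type*} [CommRing Q] {X : Type*} [AddCommGroup X] [Module Q X]
    {κ : Type*} [DecidableEq κ] (G : κ → Submodule Q X) (hG : ⨆ i, G i = ⊤)
    {Y : κ → Type*} [∀ i, AddCommGroup (Y i)] [∀ i, Module Q (Y i)] (c : ∀ i, X →ₗ[Q] Y i)
    (h1 : ∀ i j, j ≠ i → ∀ x ∈ G j, c i x = 0) (h2 : ∀ i, ∀ x ∈ G i, c i x = 0 → x = 0) :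
    DirectSum.IsInternal G := by
  refine DirectSum.isInternal_submodule_of_iSupIndep_of_iSup_eq_top ?_ hG
  refine iSupIndep_of_dfinsupp_lsum_injective _ ?_
  rw [← LinearMap.ker_eq_bot, LinearMap.ker_eq_bot']
  intro v hv
  have key : ∀ w : Π₀ i, G i, ∀ i,
      c i (DFinsupp.lsum ℕ (fun i => (G i).subtype) w) = c i (w i) := by
    intro w i
    induction w using DFinsupp.induction with
    | h0 => simp
    | ha j b w _ _ ih =>
      simp only [map_add, ih, DFinsupp.add_apply, Submodule.coe_add]
      congr 1
      rw [DFinsupp.lsum_single, Submodule.subtype_apply]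
      by_cases h : j = i
      · subst h; simp
      · rw [h1 i j h b b.2, DFinsupp.single_eq_of_ne (Ne.symm h), Submodule.coe_zero, map_zero]
  ext i
  have := key v i
  rw [hv, map_zero] at this
  simpa using h2 i _ (v i).2 this.symm

theorem isInternal_of_coaction {Q : Type*} [CommRing Q] {X : Type*} [AddCommGroup X] [Module Q X]
    {κ : Type*} [DecidableEq κ] (G : κ → Submodule Q X) (hG : ⨆ i, G i = ⊤)
    (c : X →ₗ[Q] (κ →₀ X)) (hc : ∀ i, ∀ x ∈ G i, c x = Finsupp.single i x) :
    DirectSum.IsInternal G := by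
  refine isInternal_of_detect G hG (fun i => (Finsupp.lapply i).comp c) ?_ ?_
  · intro i j h x hx
    simp [hc j x hx, Finsupp.single_eq_of_ne (Ne.symm h)]
  · intro i x hx h
    simpa [hc i x hx] using h

/-- Conversely, a decomposition gives the map sending `x` of degree `i` to `x` placed at `i`. -/
theorem exists_coaction {Q : Type*} [CommRing Q] {X : Type*} [AddCommGroup X] [Module Q X]
    {κ : Type*} [DecidableEq κ] (G : κ → Submodule Q X) (h : DirectSum.IsInternal G) :
    ∃ c : X →ₗ[Q] (κ →₀ X), ∀ i, ∀ x ∈ G i, c x = Finsupp.single i x := by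
  let e := LinearEquiv.ofBijective (DirectSum.coeLinearMap G) h
  refine ⟨(DirectSum.toModule Q κ (κ →₀ X)
    (fun i => (Finsupp.lsingle i).comp (G i).subtype)).comp e.symm.toLinearMap, ?_⟩
  intro i x hx
  have : e.symm x = DirectSum.lof Q κ (fun i => G i) i ⟨x, hx⟩ := by
    rw [LinearEquiv.symm_apply_eq]
    exact (DirectSum.coeLinearMap_lof G i ⟨x, hx⟩).symm
  simp [this]

/-- The total grading on a tensor product: degree `k` is spanned by the `x ⊗ y` with
`|x| + |y| = k`. -/
def tensorGrading {Q : Type*} [CommRing Q] {X Y : Type*} [AddCommGroup X] [Module Q X]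
    [AddCommGroup Y] [Module Q Y] (G : ℤ → Submodule Q X) (H : ℤ → Submodule Q Y) (k : ℤ) :
    Submodule Q (X ⊗[Q] Y) :=
  Submodule.span Q {t | ∃ i j : ℤ, i + j = k ∧ ∃ x ∈ G i, ∃ y ∈ H j, t = x ⊗ₜ[Q] y}

theorem isInternal_tensorGrading {Q : Type*} [CommRing Q] {X Y : Type*} [AddCommGroup X]
    [Module Q X] [AddCommGroup Y] [Module Q Y] (G : ℤ → Submodule Q X) (H : ℤ → Submodule Q Y)
    (hG : DirectSum.IsInternal G) (hH : DirectSum.IsInternal H) :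
    DirectSum.IsInternal (tensorGrading G H) := by
  obtain ⟨c, hc⟩ := exists_coaction G hG
  obtain ⟨c', hc'⟩ := exists_coaction H hH
  refine isInternal_of_coaction _ ?_
    ((Finsupp.lmapDomain (X ⊗[Q] Y) Q (fun p : ℤ × ℤ => p.1 + p.2)).comp
      ((finsuppTensorFinsupp Q Q X Y ℤ ℤ).toLinearMap.comp (TensorProduct.map c c'))) ?_
  · rw [eq_top_iff]
    rintro t -
    induction t with
    | zero => exact zero_mem _
    | add a b ha hb => exact add_mem ha hb
    | tmul x y =>
      have hx : x ∈ ⨆ i, G i := by rw [hG.submodule_iSup_eq_top]; trivial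
      have hy : y ∈ ⨆ i, H i := by rw [hH.submodule_iSup_eq_top]; trivial
      induction hx using Submodule.iSup_induction' with
      | zero => rw [TensorProduct.zero_tmul]; exact zero_mem _
      | add a b _ _ ha hb => rw [TensorProduct.add_tmul]; exact add_mem ha hb
      | mem i x hx =>
        induction hy using Submodule.iSup_induction' with
        | zero => rw [TensorProduct.tmul_zero]; exact zero_mem _
        | add a b _ _ ha hb => rw [TensorProduct.tmul_add]; exact add_mem ha hb
        | mem j y hy =>
          exact Submodule.mem_iSup_of_mem (i + j)
            (Submodule.subset_span ⟨i, j, rfl, x, hx, y, hy, rfl⟩)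
  · intro k t ht
    induction ht using Submodule.span_induction with
    | zero => simp
    | add a b _ _ ha hb => rw [map_add, ha, hb, Finsupp.single_add]
    | smul q a _ ha => rw [map_smul, ha, Finsupp.smul_single]
    | mem t ht =>
      obtain ⟨i, j, rfl, x, hx, y, hy, rfl⟩ := ht
      simp [hc i x hx, hc' j y hy, Finsupp.mapDomain_single]

/-! ### DG algebras and DG modules -/

/-- A graded-commutative DG `Q`-algebra, with homological grading `gr` over `ℤ`
and differential `d` of degree `-1`. -/
structure DGAlgebra (Q : Type u) [CommRing Q] where
  carrier : Type u
  [ring : Ring carrier]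
  [algebra : Algebra Q carrier]
  gr : ℤ → Submodule Q carrier
  internal : DirectSum.IsInternal gr
  one_mem : (1 : carrier) ∈ gr 0
  mul_mem : ∀ i j : ℤ, ∀ a ∈ gr i, ∀ b ∈ gr j, a * b ∈ gr (i + j)
  graded_comm : ∀ i j : ℤ, ∀ a ∈ gr i, ∀ b ∈ gr j, a * b = (i * j).negOnePow • (b * a)
  d : carrier →ₗ[Q] carrier
  d_mem : ∀ i : ℤ, ∀ a ∈ gr i, d a ∈ gr (i - 1)
  d_d : ∀ a, d (d a) = 0
  leibniz : ∀ i : ℤ, ∀ a ∈ gr i, ∀ b, d (a * b) = d a * b + i.negOnePow • (a * d b)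

attribute [instance] DGAlgebra.ring DGAlgebra.algebra

instance {Q : Type u} [CommRing Q] : CoeSort (DGAlgebra Q) (Type u) := ⟨DGAlgebra.carrier⟩

/-- A (left) DG module over the DG algebra `A`. -/
structure DGModule {Q : Type u} [CommRing Q] (A : DGAlgebra Q) where
  carrier : Type u
  [addCommGroup : AddCommGroup carrier]
  [module : Module Q carrier]
  [moduleAlg : Module A carrier]
  [tower : IsScalarTower Q A carrier]
  gr : ℤ → Submodule Q carrier
  internal : DirectSum.IsInternal gr
  smul_mem : ∀ i j : ℤ, ∀ a ∈ A.gr i, ∀ x ∈ gr j, a • x ∈ gr (i + j)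
  d : carrier →ₗ[Q] carrier
  d_mem : ∀ i : ℤ, ∀ x ∈ gr i, d x ∈ gr (i - 1)
  d_d : ∀ x, d (d x) = 0
  leibniz : ∀ i : ℤ, ∀ a ∈ A.gr i, ∀ x, d (a • x) = A.d a • x + i.negOnePow • (a • d x)

attribute [instance] DGModule.addCommGroup DGModule.module DGModule.moduleAlg DGModule.tower

instance {Q : Type u} [CommRing Q] (A : DGAlgebra Q) : CoeSort (DGModule A) (Type u) :=
  ⟨DGModule.carrier⟩

namespace DGModule

variable {Q : Type u} [CommRing Q] {A : DGAlgebra Q}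

/-- `φ` is a degree `e` map of DG `A`-modules, that is, an element of `Hom_A(X, Y)_e`. -/
def IsDegreeMap (X Y : DGModule A) (e : ℤ) (φ : X →ₗ[Q] Y) : Prop :=
  (∀ i : ℤ, ∀ x ∈ X.gr i, φ x ∈ Y.gr (i + e)) ∧
    ∀ j : ℤ, ∀ a ∈ A.gr j, ∀ x, φ (a • x) = (e * j).negOnePow • (a • φ x)

/-- Morphisms of DG `A`-modules: degree `0` maps commuting with the differentials. -/
structure Hom (X Y : DGModule A) where
  map : X →ₗ[Q] Y
  isDegreeMap : IsDegreeMap X Y 0 map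
  comm : ∀ x, map (X.d x) = Y.d (map x)

/-- Isomorphisms of DG `A`-modules. -/
structure Iso (X Y : DGModule A) where
  hom : Hom X Y
  inv : Hom Y X
  hom_inv : ∀ x, inv.map (hom.map x) = x
  inv_hom : ∀ y, hom.map (inv.map y) = y

/-- Two morphisms are homotopic if their difference is `∂τ + τ∂` with `τ ∈ Hom_A(X, Y)_1`. -/
def Homotopic {X Y : DGModule A} (α β : Hom X Y) : Prop :=
  ∃ τ : X →ₗ[Q] Y, IsDegreeMap X Y 1 τ ∧ ∀ x, Y.d (τ x) + τ (X.d x) = α.map x - β.map x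

/-- The homology of `X`: cycles modulo boundaries. -/
abbrev Homology (X : DGModule A) : Type u :=
  LinearMap.ker X.d ⧸ (LinearMap.range X.d).submoduleOf (LinearMap.ker X.d)

/-- The map induced on cycles. -/
def Hom.cyclesMap {X Y : DGModule A} (α : Hom X Y) : LinearMap.ker X.d →ₗ[Q] LinearMap.ker Y.d :=
  α.map.restrict fun x hx => by
    rw [LinearMap.mem_ker] at hx ⊢
    rw [← α.comm, hx, map_zero]

/-- The map induced on homology. -/
def Hom.homologyMap {X Y : DGModule A} (α : Hom X Y) : X.Homology →ₗ[Q] Y.Homology :=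
  Submodule.mapQ _ _ α.cyclesMap fun x hx => by
    obtain ⟨w, hw⟩ := hx
    exact ⟨α.map w, by rw [← α.comm, hw]; rfl⟩

/-- Quasi-isomorphisms. -/
def Hom.IsQuasiIso {X Y : DGModule A} (α : Hom X Y) : Prop :=
  Function.Bijective α.homologyMap

/-- `P` is semiprojective: morphisms from `P` lift through surjective quasi-isomorphisms,
uniquely up to homotopy. -/
def IsSemiprojective (P : DGModule A) : Prop :=
  ∀ (X Y : DGModule A) (α : Hom P Y) (γ : Hom X Y),
    Function.Surjective γ.map → γ.IsQuasiIso →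
      ∃ β : Hom P X, (∀ x, γ.map (β.map x) = α.map x) ∧
        ∀ β' : Hom P X, (∀ x, γ.map (β'.map x) = α.map x) → Homotopic β' β

/-- `X_i = 0` for all sufficiently small `i`. -/
def BoundedBelow (X : DGModule A) : Prop :=
  ∃ N : ℤ, ∀ i < N, X.gr i = ⊥

/-- The perturbation `X^δ` of `X` by a `δ ∈ Z_{-1}(Hom_A(X, X))` with `δ² = 0`: the same graded
module with differential `∂ + δ`. -/
def perturb (X : DGModule A) (δ : X →ₗ[Q] X) (hδ : IsDegreeMap X X (-1) δ)
    (hcyc : ∀ x, X.d (δ x) + δ (X.d x) = 0) (hsq : ∀ x, δ (δ x) = 0) : DGModule A where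
  carrier := X
  gr := X.gr
  internal := X.internal
  smul_mem := X.smul_mem
  d := X.d + δ
  d_mem i x hx := add_mem (X.d_mem i x hx) (hδ.1 i x hx)
  d_d x := by
    simp only [LinearMap.add_apply, map_add, X.d_d, hsq, zero_add, add_zero]
    rw [add_comm]
    exact hcyc x
  leibniz i a ha x := by
    simp only [LinearMap.add_apply, X.leibniz i a ha, hδ.2 i a ha, smul_add]
    rw [show (-1 * i) = -i by ring, Int.negOnePow_neg]
    abel

end DGModule

/-- Morphisms of DG algebras. -/
structure DGAlgebra.Hom {Q : Type u} [CommRing Q] (A B : DGAlgebra Q) where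
  map : A →ₐ[Q] B
  map_mem : ∀ i : ℤ, ∀ a ∈ A.gr i, map a ∈ B.gr i
  comm : ∀ a, map (A.d a) = B.d (map a)

/-- Restriction of scalars along a morphism of DG algebras. -/
def DGModule.restrictScalars {Q : Type u} [CommRing Q] {A B : DGAlgebra Q} (φ : DGAlgebra.Hom A B)
    (X : DGModule B) : DGModule A :=
  letI : Module A X := Module.compHom X (φ.map : A →+* B)
  haveI : IsScalarTower Q A X := ⟨fun q a x => by
    change φ.map (q • a) • x = q • (φ.map a • x)
    rw [map_smul, smul_assoc]⟩
  { carrier := X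
    gr := X.gr
    internal := X.internal
    smul_mem := fun i j a ha x hx => X.smul_mem i j (φ.map a) (φ.map_mem i a ha) x hx
    d := X.d
    d_mem := X.d_mem
    d_d := X.d_d
    leibniz := fun i a ha x => by
      have := X.leibniz i (φ.map a) (φ.map_mem i a ha) x
      rw [← φ.comm] at this
      exact this }

/-! ### Tensor products with an evenly graded factor

If `S` is concentrated in even degrees, the sign `(-1)^{|a||s|}` in the product
`(t ⊗ a)(s ⊗ b) = (-1)^{|a||s|} ts ⊗ ab` is trivial and so is the differential of `S`; the same
holds for the action on `T ⊗ X` and its differential, if `T` is concentrated in even degrees. -/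

/-- `S` is concentrated in even degrees. -/
def DGAlgebra.IsEven {Q : Type u} [CommRing Q] (S : DGAlgebra Q) : Prop :=
  ∀ i : ℤ, Odd i → S.gr i = ⊥

/-- `T` is concentrated in even degrees. -/
def DGModule.IsEven {Q : Type u} [CommRing Q] {S : DGAlgebra Q} (T : DGModule S) : Prop :=
  ∀ i : ℤ, Odd i → T.gr i = ⊥

/-- The DG algebra `S ⊗_Q A`, for `S` concentrated in even degrees. -/
def DGAlgebra.tensor {Q : Type u} [CommRing Q] (S : DGAlgebra Q) (hS : S.IsEven)
    (A : DGAlgebra Q) : DGAlgebra Q where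
  carrier := S ⊗[Q] A
  gr := tensorGrading S.gr A.gr
  internal := isInternal_tensorGrading _ _ S.internal A.internal
  one_mem := Submodule.subset_span ⟨0, 0, rfl, 1, S.one_mem, 1, A.one_mem, rfl⟩
  mul_mem := by
    intro i j a ha b hb
    induction ha using Submodule.span_induction with
    | zero => rw [zero_mul]; exact zero_mem _
    | add a a' _ _ h h' => rw [add_mul]; exact add_mem h h'
    | smul q a _ h => rw [smul_mul_assoc]; exact Submodule.smul_mem _ _ h
    | mem a ha =>
      obtain ⟨i₁, i₂, rfl, s, hs, a, ha, rfl⟩ := ha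
      induction hb using Submodule.span_induction with
      | zero => rw [mul_zero]; exact zero_mem _
      | add a a' _ _ h h' => rw [mul_add]; exact add_mem h h'
      | smul q a _ h => rw [mul_smul_comm]; exact Submodule.smul_mem _ _ h
      | mem b hb =>
        obtain ⟨j₁, j₂, rfl, t, ht, b, hb, rfl⟩ := hb
        exact Submodule.subset_span ⟨i₁ + j₁, i₂ + j₂, by ring, s * t, S.mul_mem _ _ s hs t ht,
          a * b, A.mul_mem _ _ a ha b hb, Algebra.TensorProduct.tmul_mul_tmul _ _ _ _⟩
  graded_comm := by
    intro i j a ha b hb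
    induction ha using Submodule.span_induction with
    | zero => simp
    | add a a' _ _ h h' => rw [add_mul, mul_add, h, h', smul_add]
    | smul q a _ h => rw [smul_mul_assoc, mul_smul_comm, h, smul_comm]
    | mem a ha =>
      obtain ⟨i₁, i₂, rfl, s, hs, a, ha, rfl⟩ := ha
      induction hb using Submodule.span_induction with
      | zero => simp
      | add a a' _ _ h h' => rw [add_mul _ _ (s ⊗ₜ[Q] _), mul_add, h, h', smul_add]
      | smul q a _ h => rw [smul_mul_assoc, mul_smul_comm, h, smul_comm]
      | mem b hb =>
        obtain ⟨j₁, j₂, rfl, t, ht, b, hb, rfl⟩ := hb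
        rw [Algebra.TensorProduct.tmul_mul_tmul, Algebra.TensorProduct.tmul_mul_tmul]
        rcases Int.even_or_odd i₁ with hi | hi
        swap
        · rw [hS _ hi, Submodule.mem_bot] at hs; simp [hs]
        rcases Int.even_or_odd j₁ with hj | hj
        swap
        · rw [hS _ hj, Submodule.mem_bot] at ht; simp [ht]
        rw [S.graded_comm _ _ s hs t ht, A.graded_comm _ _ a ha b hb,
          Int.negOnePow_even _ (hi.mul_right _), one_smul,
          show (i₁ + i₂) * (j₁ + j₂) = (i₁ * (j₁ + j₂) + i₂ * j₁) + i₂ * j₂ by ring,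
          Int.negOnePow_add,
          Int.negOnePow_even _ ((hi.mul_right _).add (hj.mul_left _)), one_mul]
        simp only [Units.smul_def, TensorProduct.tmul_smul]
  d := A.d.lTensor S
  d_mem := by
    intro i a ha
    induction ha using Submodule.span_induction with
    | zero => rw [map_zero]; exact zero_mem _
    | add a a' _ _ h h' => rw [map_add]; exact add_mem h h'
    | smul q a _ h => rw [map_smul]; exact Submodule.smul_mem _ _ h
    | mem a ha =>
      obtain ⟨i₁, i₂, rfl, s, hs, a, ha, rfl⟩ := ha
      exact Submodule.subset_span ⟨i₁, i₂ - 1, by ring, s, hs, A.d a, A.d_mem _ a ha, rfl⟩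
  d_d := by
    intro a
    induction a with
    | zero => simp
    | add a b ha hb => rw [map_add, map_add, ha, hb, add_zero]
    | tmul s a => simp [A.d_d]
  leibniz := by
    intro i a ha b
    induction ha using Submodule.span_induction with
    | zero => simp
    | add a a' _ _ h h' => simp only [add_mul, map_add, h, h', smul_add]; abel
    | smul q a _ h =>
      simp only [smul_mul_assoc, map_smul, h, smul_add]
      rw [smul_comm q]
    | mem a ha =>
      obtain ⟨i₁, i₂, rfl, s, hs, a, ha, rfl⟩ := ha
      rcases Int.even_or_odd i₁ with hi | hi
      swap
      · rw [hS _ hi, Submodule.mem_bot] at hs; simp [hs]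
      induction b with
      | zero => simp
      | add b b' h h' => simp only [mul_add, map_add, h, h', smul_add]; abel
      | tmul t b =>
        simp only [Algebra.TensorProduct.tmul_mul_tmul, LinearMap.lTensor_tmul,
          A.leibniz _ a ha, TensorProduct.tmul_add, Int.negOnePow_add, Int.negOnePow_even _ hi,
          one_mul, Units.smul_def, TensorProduct.tmul_smul]

/-- The action of `S ⊗_Q A` on `T ⊗_Q X`, with `(s ⊗ a)(t ⊗ x) = st ⊗ ax`. -/
def DGModule.tensorAction {Q : Type u} [CommRing Q] {S A : DGAlgebra Q} (T : DGModule S)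
    (X : DGModule A) : S ⊗[Q] A →ₐ[Q] Module.End Q (T ⊗[Q] X) :=
  Module.endTensorEndAlgHom.comp
    (Algebra.TensorProduct.map (Algebra.lsmul Q Q T) (Algebra.lsmul Q Q X))

theorem DGModule.tensorAction_tmul {Q : Type u} [CommRing Q] {S A : DGAlgebra Q} (T : DGModule S)
    (X : DGModule A) (s : S) (a : A) (t : T) (x : X) :
    T.tensorAction X (s ⊗ₜ a) (t ⊗ₜ x) = (s • t) ⊗ₜ (a • x) := rfl

theorem DGModule.tensorAction_mem {Q : Type u} [CommRing Q] {S A : DGAlgebra Q} (T : DGModule S)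
    (X : DGModule A) (i j : ℤ) (a : S ⊗[Q] A) (ha : a ∈ tensorGrading S.gr A.gr i)
    (b : T ⊗[Q] X) (hb : b ∈ tensorGrading T.gr X.gr j) :
    T.tensorAction X a b ∈ tensorGrading T.gr X.gr (i + j) := by
  induction ha using Submodule.span_induction with
  | zero => rw [map_zero]; exact zero_mem _
  | add a a' _ _ h h' => rw [map_add]; exact add_mem h h'
  | smul q a _ h => rw [map_smul]; exact Submodule.smul_mem _ _ h
  | mem a ha =>
    obtain ⟨i₁, i₂, rfl, s, hs, a, ha, rfl⟩ := ha
    induction hb using Submodule.span_induction with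
    | zero => rw [map_zero]; exact zero_mem _
    | add a a' _ _ h h' => rw [map_add]; exact add_mem h h'
    | smul q a _ h => rw [map_smul]; exact Submodule.smul_mem _ _ h
    | mem b hb =>
      obtain ⟨j₁, j₂, rfl, t, ht, b, hb, rfl⟩ := hb
      exact Submodule.subset_span ⟨i₁ + j₁, i₂ + j₂, by ring, s • t, T.smul_mem _ _ s hs t ht,
        a • b, X.smul_mem _ _ a ha b hb, rfl⟩

theorem DGModule.tensorAction_leibniz {Q : Type u} [CommRing Q] {S A : DGAlgebra Q}
    (hS : S.IsEven) (T : DGModule S) (X : DGModule A) (i : ℤ) (a : S ⊗[Q] A)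
    (ha : a ∈ tensorGrading S.gr A.gr i) (b : T ⊗[Q] X) :
    X.d.lTensor T (T.tensorAction X a b) =
      T.tensorAction X (A.d.lTensor S a) b +
        i.negOnePow • T.tensorAction X a (X.d.lTensor T b) := by
  induction ha using Submodule.span_induction with
  | zero => simp
  | add a a' _ _ h h' =>
    simp only [map_add, LinearMap.add_apply, h, h', smul_add]; abel
  | smul q a _ h =>
    simp only [map_smul, LinearMap.smul_apply, h, smul_add]
    rw [smul_comm q]
  | mem a ha =>
    obtain ⟨i₁, i₂, rfl, s, hs, a, ha, rfl⟩ := ha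
    rcases Int.even_or_odd i₁ with hi | hi
    swap
    · rw [hS _ hi, Submodule.mem_bot] at hs; simp [hs]
    induction b with
    | zero => simp
    | add b b' h h' => simp only [map_add, h, h', smul_add]; abel
    | tmul t b =>
      simp only [LinearMap.lTensor_tmul, DGModule.tensorAction_tmul,
        X.leibniz _ a ha, TensorProduct.tmul_add, Int.negOnePow_add, Int.negOnePow_even _ hi,
        one_mul, Units.smul_def, TensorProduct.tmul_smul]

theorem DGModule.tensorAction_comm {Q : Type u} [CommRing Q] {S A : DGAlgebra Q} (T : DGModule S)
    (X : DGModule A) (w r : S ⊗[Q] A) (x : T ⊗[Q] X) (e : ℤˣ) (h : w * r = e • (r * w)) :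
    T.tensorAction X w (T.tensorAction X r x) =
      e • T.tensorAction X r (T.tensorAction X w x) := by
  rw [← Module.End.mul_apply, ← Module.End.mul_apply, ← map_mul, ← map_mul, h, Units.smul_def,
    Units.smul_def, map_zsmul]
  rfl

/-- The DG `S ⊗_Q A`-module `T ⊗_Q X`, for `S` and `T` concentrated in even degrees. -/
def DGModule.tensor {Q : Type u} [CommRing Q] {S A : DGAlgebra Q} (hS : S.IsEven)
    (T : DGModule S) (_hT : T.IsEven) (X : DGModule A) : DGModule (S.tensor hS A) :=
  letI : Module (S.tensor hS A) (T ⊗[Q] X) :=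
    Module.compHom (T ⊗[Q] X) (T.tensorAction X : S ⊗[Q] A →+* Module.End Q (T ⊗[Q] X))
  haveI : IsScalarTower Q (S.tensor hS A) (T ⊗[Q] X) := ⟨fun q r z =>
    LinearMap.congr_fun (map_smul (T.tensorAction X) q r) z⟩
  { carrier := T ⊗[Q] X
    gr := tensorGrading T.gr X.gr
    internal := isInternal_tensorGrading _ _ T.internal X.internal
    smul_mem := T.tensorAction_mem X
    d := X.d.lTensor T
    d_mem := by
      intro i a ha
      induction ha using Submodule.span_induction with
      | zero => rw [map_zero]; exact zero_mem _
      | add a a' _ _ h h' => rw [map_add]; exact add_mem h h'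
      | smul q a _ h => rw [map_smul]; exact Submodule.smul_mem _ _ h
      | mem a ha =>
        obtain ⟨i₁, i₂, rfl, s, hs, a, ha, rfl⟩ := ha
        exact Submodule.subset_span ⟨i₁, i₂ - 1, by ring, s, hs, X.d a, X.d_mem _ a ha, rfl⟩
    d_d := by
      intro a
      induction a with
      | zero => simp
      | add a b ha hb => rw [map_add, map_add, ha, hb, add_zero]
      | tmul s a => simp [X.d_d]
    leibniz := T.tensorAction_leibniz hS X }

/-! ### Koszul complexes -/

section Koszul

variable {Q : Type u} [CommRing Q] {κ : Type}

/-- The exterior algebra, graded over `ℤ`. -/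
def exteriorGrading (Q : Type u) [CommRing Q] (V : Type*) [AddCommGroup V] [Module Q V] :
    ℤ → Submodule Q (ExteriorAlgebra Q V)
  | Int.ofNat k => ⋀[Q]^k V
  | Int.negSucc _ => ⊥

theorem isInternal_exteriorGrading (V : Type*) [AddCommGroup V] [Module Q V] :
    DirectSum.IsInternal (exteriorGrading Q V) := by
  have h := DirectSum.Decomposition.isInternal (fun i : ℕ ↦ ⋀[Q]^i V)
  obtain ⟨c, hc⟩ := exists_coaction _ h
  refine isInternal_of_coaction _ ?_
    ((Finsupp.lmapDomain (ExteriorAlgebra Q V) Q Int.ofNat).comp c) ?_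
  · rw [eq_top_iff, ← h.submodule_iSup_eq_top]
    exact iSup_le fun i => le_iSup (exteriorGrading Q V) (Int.ofNat i)
  · rintro (k | k) x hx
    · simp [hc k x hx, Finsupp.mapDomain_single]
    · rw [show x = 0 from hx]; simp

/-- Induction on homogeneous elements of the exterior algebra. -/
theorem exteriorGrading_induction {V : Type*} [AddCommGroup V] [Module Q V]
    {C : ℕ → ExteriorAlgebra Q V → Prop}
    (h0 : ∀ r, C 0 (algebraMap Q _ r))
    (hadd : ∀ k x y, C k x → C k y → C k (x + y))
    (hmul : ∀ k v x, x ∈ ⋀[Q]^k V → C k x → C (k + 1) (ExteriorAlgebra.ι Q v * x))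
    (k : ℕ) (x : ExteriorAlgebra Q V) (hx : x ∈ ⋀[Q]^k V) : C k x := by
  induction hx using Submodule.pow_induction_on_left' with
  | algebraMap r => exact h0 r
  | add x y i _ _ hx hy => exact hadd i x y hx hy
  | mem_mul m hm i x hx ih =>
    obtain ⟨v, rfl⟩ := hm
    exact hmul i v x hx ih

theorem ι_mem_exteriorPower_one {V : Type*} [AddCommGroup V] [Module Q V] (v : V) :
    ExteriorAlgebra.ι Q v ∈ ⋀[Q]^1 V := by
  rw [ExteriorAlgebra.exteriorPower, pow_one]
  exact LinearMap.mem_range_self _ v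

theorem ι_mul_mem_exteriorPower {V : Type*} [AddCommGroup V] [Module Q V] (v : V) (k : ℕ)
    (x : ExteriorAlgebra Q V) (hx : x ∈ ⋀[Q]^k V) :
    ExteriorAlgebra.ι Q v * x ∈ ⋀[Q]^(k + 1) V := by
  rw [ExteriorAlgebra.exteriorPower, pow_succ']
  exact Submodule.mul_mem_mul (LinearMap.mem_range_self _ _) hx

theorem algebraMapInv_ι {V : Type*} [AddCommGroup V] [Module Q V] (v : V) :
    (ExteriorAlgebra.algebraMapInv (ExteriorAlgebra.ι Q v) : Q) = 0 := by
  simp [ExteriorAlgebra.algebraMapInv]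

theorem algebraMapInv_eq_zero {V : Type*} [AddCommGroup V] [Module Q V] (k : ℕ)
    (x : ExteriorAlgebra Q V) (hx : x ∈ ⋀[Q]^(k + 1) V) :
    (ExteriorAlgebra.algebraMapInv x : Q) = 0 := by
  rw [ExteriorAlgebra.exteriorPower, pow_succ'] at hx
  induction hx using Submodule.mul_induction_on' with
  | mem_mul_mem v hv b _ =>
    obtain ⟨v, rfl⟩ := hv
    rw [map_mul, algebraMapInv_ι, zero_mul]
  | add x _ y _ hx hy => rw [map_add, hx, hy, add_zero]

theorem map_mem_exteriorPower {V W : Type*} [AddCommGroup V] [Module Q V] [AddCommGroup W]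
    [Module Q W] (φ : V →ₗ[Q] W) (k : ℕ) (x : ExteriorAlgebra Q V) (hx : x ∈ ⋀[Q]^k V) :
    ExteriorAlgebra.map φ x ∈ ⋀[Q]^k W := by
  refine exteriorGrading_induction
    (C := fun k x => ExteriorAlgebra.map φ x ∈ ⋀[Q]^k W) ?_ ?_ ?_ k x hx
  · intro r
    rw [AlgHom.commutes]
    exact SetLike.algebraMap_mem_graded (fun i : ℕ ↦ ⋀[Q]^i W) r
  · intro k x y hx hy
    rw [map_add]; exact add_mem hx hy
  · intro k v x _ ih
    rw [map_mul, ExteriorAlgebra.map_apply_ι]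
    exact ι_mul_mem_exteriorPower _ _ _ ih

theorem ι_mul_graded_comm {V : Type*} [AddCommGroup V] [Module Q V] (v : V) (k : ℕ)
    (x : ExteriorAlgebra Q V) (hx : x ∈ ⋀[Q]^k V) :
    ExteriorAlgebra.ι Q v * x = (k : ℤ).negOnePow • (x * ExteriorAlgebra.ι Q v) := by
  refine exteriorGrading_induction
    (C := fun k x => ExteriorAlgebra.ι Q v * x =
      (k : ℤ).negOnePow • (x * ExteriorAlgebra.ι Q v)) ?_ ?_ ?_ k x hx
  · intro r
    simp [Algebra.commutes]
  · intro k x y hx hy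
    rw [mul_add, add_mul, hx, hy, smul_add]
  · intro k w x _ ih
    rw [← mul_assoc, eq_neg_of_add_eq_zero_left (ExteriorAlgebra.ι_add_mul_swap v w), neg_mul,
      mul_assoc, ih, Nat.cast_add, Nat.cast_one, Int.negOnePow_succ, mul_assoc, mul_smul_comm,
      Units.neg_smul]

theorem exterior_graded_comm {V : Type*} [AddCommGroup V] [Module Q V] (k l : ℕ)
    (x y : ExteriorAlgebra Q V) (hx : x ∈ ⋀[Q]^k V) (hy : y ∈ ⋀[Q]^l V) :
    x * y = ((k : ℤ) * l).negOnePow • (y * x) := by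
  refine exteriorGrading_induction
    (C := fun k x => x * y = ((k : ℤ) * l).negOnePow • (y * x)) ?_ ?_ ?_ k x hx
  · intro r
    simp [Algebra.commutes]
  · intro k x x' hx hx'
    rw [mul_add, add_mul, hx, hx', smul_add]
  · intro k w x _ ih
    rw [mul_assoc, ih, mul_smul_comm, ← mul_assoc, ι_mul_graded_comm w l y hy, smul_mul_assoc,
      smul_smul, mul_assoc, ← Int.negOnePow_add]
    congr 2
    push_cast
    ring

/-- The `Q`-linear functional `ξ_i ↦ h_i` on the free module with basis `ξ_i`. -/
abbrev koszulFunctional (h : κ → Q) : Module.Dual Q (κ →₀ Q) := Finsupp.linearCombination Q h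

/-- The Koszul differential: the antiderivation of the exterior algebra with `∂ξ_i = h_i`. -/
def koszulD (h : κ → Q) : ExteriorAlgebra Q (κ →₀ Q) →ₗ[Q] ExteriorAlgebra Q (κ →₀ Q) :=
  CliffordAlgebra.contractLeft (Q := (0 : QuadraticForm Q (κ →₀ Q))) (koszulFunctional h)

theorem koszulD_algebraMap (h : κ → Q) (r : Q) : koszulD h (algebraMap Q _ r) = 0 :=
  CliffordAlgebra.contractLeft_algebraMap _ _ r

theorem koszulD_ι_mul (h : κ → Q) (v : κ →₀ Q) (x : ExteriorAlgebra Q (κ →₀ Q)) :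
    koszulD h (ExteriorAlgebra.ι Q v * x) =
      koszulFunctional h v • x - ExteriorAlgebra.ι Q v * koszulD h x :=
  CliffordAlgebra.contractLeft_ι_mul _ _ _

theorem koszulD_mem (h : κ → Q) (k : ℕ) (x : ExteriorAlgebra Q (κ →₀ Q))
    (hx : x ∈ ⋀[Q]^k (κ →₀ Q)) :
    koszulD h x ∈ exteriorGrading Q (κ →₀ Q) ((k : ℤ) - 1) := by
  refine exteriorGrading_induction
    (C := fun k x => koszulD h x ∈ exteriorGrading Q (κ →₀ Q) ((k : ℤ) - 1)) ?_ ?_ ?_ k x hx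
  · intro r
    rw [koszulD_algebraMap]; exact zero_mem _
  · intro k x y hx hy
    rw [map_add]; exact add_mem hx hy
  · intro k v x hx ih
    rw [koszulD_ι_mul, Nat.cast_add, Nat.cast_one, add_sub_cancel_right]
    refine sub_mem (Submodule.smul_mem _ _ hx) ?_
    cases k with
    | zero =>
      have : koszulD h x = 0 := ih
      rw [this, mul_zero]; exact zero_mem _
    | succ k =>
      rw [Nat.cast_add, Nat.cast_one, add_sub_cancel_right] at ih
      exact ι_mul_mem_exteriorPower _ _ _ ih

theorem koszulD_leibniz (h : κ → Q) (k : ℕ) (x y : ExteriorAlgebra Q (κ →₀ Q))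
    (hx : x ∈ ⋀[Q]^k (κ →₀ Q)) :
    koszulD h (x * y) = koszulD h x * y + (k : ℤ).negOnePow • (x * koszulD h y) := by
  refine exteriorGrading_induction
    (C := fun k x => koszulD h (x * y) =
      koszulD h x * y + (k : ℤ).negOnePow • (x * koszulD h y)) ?_ ?_ ?_ k x hx
  · intro r
    rw [koszulD_algebraMap, ← Algebra.smul_def, map_smul, ← Algebra.smul_def]
    simp
  · intro k x x' hx hx'
    simp only [add_mul, map_add, hx, hx', smul_add]; abel
  · intro k v x _ ih
    rw [mul_assoc, koszulD_ι_mul, ih, koszulD_ι_mul, Nat.cast_add, Nat.cast_one,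
      Int.negOnePow_succ, Units.neg_smul, mul_add, sub_mul, mul_smul_comm, mul_assoc, mul_assoc,
      smul_mul_assoc]
    abel

/-- The Koszul complex `Q⟨ξ_i | ∂ξ_i = h_i⟩` on a family `h`: the exterior algebra on the free
module with basis `(ξ_i)`, with `|ξ_i| = 1`. -/
def koszul (h : κ → Q) : DGAlgebra Q where
  carrier := ExteriorAlgebra Q (κ →₀ Q)
  gr := exteriorGrading Q (κ →₀ Q)
  internal := isInternal_exteriorGrading _
  one_mem := SetLike.one_mem_graded (fun i : ℕ ↦ ⋀[Q]^i (κ →₀ Q))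
  mul_mem := by
    rintro (i | i) (j | j) a ha b hb
    · exact SetLike.mul_mem_graded (A := fun i : ℕ ↦ ⋀[Q]^i (κ →₀ Q)) ha hb
    · rw [show b = 0 from hb, mul_zero]; exact zero_mem _
    all_goals rw [show a = 0 from ha, zero_mul]; exact zero_mem _
  graded_comm := by
    rintro (i | i) (j | j) a ha b hb
    · exact exterior_graded_comm i j a b ha hb
    · rw [show b = 0 from hb, mul_zero, zero_mul, smul_zero]
    all_goals rw [show a = 0 from ha, mul_zero, zero_mul, smul_zero]
  d := koszulD h
  d_mem := by
    rintro (i | i) a ha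
    · exact koszulD_mem h i a ha
    · rw [show a = 0 from ha, map_zero]; exact zero_mem _
  d_d := CliffordAlgebra.contractLeft_contractLeft (Q := (0 : QuadraticForm Q (κ →₀ Q))) _
  leibniz := by
    rintro (i | i) a ha b
    · exact koszulD_leibniz h i a b ha
    · rw [show a = 0 from ha]; simp

/-- The generator `ξ_i` of the Koszul complex. -/
def koszulGen (h : κ → Q) (i : κ) : koszul h :=
  ExteriorAlgebra.ι Q (Finsupp.single i (1 : Q))

theorem koszulGen_mem (h : κ → Q) (i : κ) : koszulGen h i ∈ (koszul h).gr 1 := by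
  exact ι_mem_exteriorPower_one _

theorem koszulGen_sq (h : κ → Q) (i : κ) : koszulGen h i * koszulGen h i = 0 :=
  ExteriorAlgebra.ι_sq_zero _

theorem koszulGen_d (h : κ → Q) (i : κ) :
    (koszul h).d (koszulGen h i) = algebraMap Q (koszul h) (h i) := by
  refine (CliffordAlgebra.contractLeft_ι (Q := (0 : QuadraticForm Q (κ →₀ Q))) _ _).trans ?_
  simp only [koszulFunctional, Finsupp.linearCombination_single, one_smul]
  rfl

theorem map_koszulD {μ : Type} (h : κ → Q) (g : μ → Q) (a : ExteriorAlgebra Q (κ →₀ Q)) :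
    ExteriorAlgebra.map (Finsupp.lmapDomain Q Q (Sum.inl : κ → κ ⊕ μ)) (koszulD h a) =
      koszulD (Sum.elim h g)
        (ExteriorAlgebra.map (Finsupp.lmapDomain Q Q (Sum.inl : κ → κ ⊕ μ)) a) := by
  induction a using CliffordAlgebra.left_induction with
  | algebraMap r =>
    have h1 := koszulD_algebraMap h r
    have h2 := koszulD_algebraMap (Sum.elim h g) r
    rw [h1, AlgHom.commutes, h2, map_zero]
  | add x y hx hy => simp only [map_add, hx, hy]
  | ι_mul x v hx =>
    have h1 := koszulD_ι_mul h v x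
    have h2 := koszulD_ι_mul (Sum.elim h g)
      (Finsupp.lmapDomain Q Q (Sum.inl : κ → κ ⊕ μ) v)
      (ExteriorAlgebra.map (Finsupp.lmapDomain Q Q (Sum.inl : κ → κ ⊕ μ)) x)
    have h3 : koszulFunctional (Sum.elim h g)
        (Finsupp.lmapDomain Q Q (Sum.inl : κ → κ ⊕ μ) v) = koszulFunctional h v := by
      simp [koszulFunctional, Finsupp.linearCombination_mapDomain]
    rw [h3] at h2
    rw [h1, map_sub, map_smul, map_mul, map_mul, ExteriorAlgebra.map_apply_ι, hx, h2]

/-- The inclusion `Q⟨ξ_i | ∂ξ_i = h_i⟩ → Q⟨ξ_i, ζ_j | ∂ξ_i = h_i, ∂ζ_j = g_j⟩`. -/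
def koszulInl {μ : Type} (h : κ → Q) (g : μ → Q) :
    DGAlgebra.Hom (koszul h) (koszul (Sum.elim h g)) where
  map := (ExteriorAlgebra.map (Finsupp.lmapDomain Q Q (Sum.inl : κ → κ ⊕ μ)) :
    ExteriorAlgebra Q (κ →₀ Q) →ₐ[Q] ExteriorAlgebra Q (κ ⊕ μ →₀ Q))
  map_mem := by
    rintro (i | i) a ha
    · exact map_mem_exteriorPower _ i a ha
    · rw [show a = 0 from ha]
      exact map_zero (ExteriorAlgebra.map (Finsupp.lmapDomain Q Q (Sum.inl : κ → κ ⊕ μ)))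
  comm := map_koszulD h g

/-- The augmentation of the Koszul complex composed with the differential. -/
theorem algebraMapInv_koszulD_smul (h : κ → Q) (M : Type*) [AddCommGroup M] [Module Q M]
    (hM : ∀ i, h i ∈ Module.annihilator Q M) (x : ExteriorAlgebra Q (κ →₀ Q)) (m : M) :
    (ExteriorAlgebra.algebraMapInv (koszulD h x) : Q) • m = 0 := by
  induction x using CliffordAlgebra.left_induction with
  | algebraMap r =>
    have h1 := koszulD_algebraMap h r
    rw [h1, map_zero, zero_smul]
  | add x y hx hy => rw [map_add, map_add, add_smul, hx, hy, add_zero]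
  | ι_mul x v _ =>
    have h1 := koszulD_ι_mul h v x
    have h2 := algebraMapInv_ι (Q := Q) v
    have h3 : koszulFunctional h v ∈ Module.annihilator Q M := by
      rw [koszulFunctional, Finsupp.linearCombination_apply]
      exact Submodule.sum_mem _ fun i _ => Ideal.mul_mem_left _ _ (hM i)
    rw [h1, map_sub, map_mul, h2, zero_mul, sub_zero, map_smul, smul_eq_mul, mul_comm, mul_smul,
      Module.mem_annihilator.mp h3 m, smul_zero]

/-- A `Q`-module `M` killed by `h`, as a DG module over the Koszul complex on `h`: it sits in
degree `0`, and the Koszul complex acts through its augmentation `ξ_i ↦ 0`. -/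
def koszulModule (h : κ → Q) (M : Type u) [AddCommGroup M] [Module Q M]
    (hM : ∀ i, h i ∈ Module.annihilator Q M) : DGModule (koszul h) :=
  letI : Module (koszul h) M := Module.compHom M
    ((ExteriorAlgebra.algebraMapInv : ExteriorAlgebra Q (κ →₀ Q) →ₐ[Q] Q) :
      ExteriorAlgebra Q (κ →₀ Q) →+* Q)
  haveI : IsScalarTower Q (koszul h) M := ⟨fun q a m => by
    have := map_smul (ExteriorAlgebra.algebraMapInv : ExteriorAlgebra Q (κ →₀ Q) →ₐ[Q] Q) q a
    exact (congrArg (· • m) this).trans (smul_assoc _ _ m)⟩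
  { carrier := M
    gr := fun i => if i = 0 then ⊤ else ⊥
    internal := by
      refine isInternal_of_coaction _ ?_ (Finsupp.lsingle 0) ?_
      · rw [eq_top_iff]
        exact le_iSup_of_le 0 (by simp)
      · intro i x hx
        by_cases hi : i = 0
        · subst hi; rfl
        · rw [if_neg hi, Submodule.mem_bot] at hx
          simp [hx]
    smul_mem := by
      intro i j a ha x hx
      by_cases hj : j = 0
      swap
      · rw [if_neg hj, Submodule.mem_bot] at hx
        rw [hx, smul_zero]; exact zero_mem _
      subst hj
      rcases i with (_ | k) | k
      · rw [if_pos (by simp)]; trivial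
      · have : a • x = (0 : Q) • x := congrArg (· • x) (algebraMapInv_eq_zero k a ha)
        rw [this, zero_smul]; exact zero_mem _
      · rw [show a = 0 from ha, zero_smul]; exact zero_mem _
    d := 0
    d_mem := fun i x _ => zero_mem _
    d_d := fun _ => rfl
    leibniz := by
      intro i a ha x
      have : (koszul h).d a • x = 0 := algebraMapInv_koszulD_smul h M hM a x
      simp [this] }

end Koszul

/-! ### Graded duals -/

section GradedDual

variable {Q R P : Type*} [CommRing Q] [CommRing R] [Algebra Q R] [CommRing P] [Algebra Q P]
  [Algebra R P] (G : ℤ → Submodule Q P)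

/-- `Hom_R(P, R)_j`: the `R`-linear maps `P → R` of degree `j`, with `R` in degree `0`, i.e.
those vanishing on `P_i` for `i ≠ -j`. -/
def dualPiece (R : Type*) [CommRing R] [Algebra Q R] [Algebra R P] (j : ℤ) :
    Submodule Q (P →ₗ[R] R) where
  carrier := {φ | ∀ i, i ≠ -j → ∀ p ∈ G i, φ p = 0}
  zero_mem' _ _ _ _ := rfl
  add_mem' ha hb i hi p hp := by
    rw [LinearMap.add_apply, ha i hi p hp, hb i hi p hp, add_zero]
  smul_mem' q φ h i hi p hp := by
    rw [LinearMap.smul_apply, h i hi p hp, smul_zero]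

/-- The underlying module of the graded dual `Hom_R(P, R) = ⨁_j Hom_R(P, R)_j`. -/
def gradedDual (R : Type*) [CommRing R] [Algebra Q R] [Algebra R P] : Submodule Q (P →ₗ[R] R) :=
  ⨆ j, dualPiece G R j

/-- The graded dual `Hom_R(P, R) = ⨁_j Hom_R(P, R)_j`. -/
def GradedDual (R : Type*) [CommRing R] [Algebra Q R] [Algebra R P] : Type _ :=
  gradedDual G R

instance (R : Type*) [CommRing R] [Algebra Q R] [Algebra R P] : AddCommGroup (GradedDual G R) :=
  inferInstanceAs (AddCommGroup (gradedDual G R))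

instance (R : Type*) [CommRing R] [Algebra Q R] [Algebra R P] : Module Q (GradedDual G R) :=
  inferInstanceAs (Module Q (gradedDual G R))

/-- The piece of degree `j` of the graded dual. -/
def gradedDualPiece (R : Type*) [CommRing R] [Algebra Q R] [Algebra R P] (j : ℤ) :
    Submodule Q (GradedDual G R) :=
  (dualPiece G R j).submoduleOf (gradedDual G R)

/-- The action of `P` on functionals: `(p φ)(q) = φ(p q)`. -/
def dualAct (Q : Type*) [CommRing Q] [Algebra Q R] (p : P) : (P →ₗ[R] R) →ₗ[Q] (P →ₗ[R] R) where
  toFun φ := φ ∘ₗ LinearMap.mulLeft R p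
  map_add' _ _ := rfl
  map_smul' _ _ := rfl

variable {G}

theorem dualAct_mem_piece
    (hmul : ∀ i j : ℤ, ∀ a ∈ G i, ∀ b ∈ G j, a * b ∈ G (i + j))
    (i j : ℤ) (p : P) (hp : p ∈ G i) (φ : P →ₗ[R] R)
    (hφ : φ ∈ dualPiece G R j) : dualAct Q p φ ∈ dualPiece G R (i + j) := by
  intro k hk q hq
  exact hφ (i + k) (by intro h; apply hk; linarith) (p * q) (hmul i k p hp q hq)

theorem dualAct_mem (hG : DirectSum.IsInternal G)
    (hmul : ∀ i j : ℤ, ∀ a ∈ G i, ∀ b ∈ G j, a * b ∈ G (i + j))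
    (p : P) (φ : P →ₗ[R] R) (hφ : φ ∈ gradedDual G R) :
    dualAct Q p φ ∈ gradedDual G R := by
  have hp : p ∈ ⨆ i, G i := by
    rw [hG.submodule_iSup_eq_top]; trivial
  induction hφ using Submodule.iSup_induction' with
  | zero => rw [map_zero]; exact zero_mem _
  | add a b _ _ ha hb => rw [map_add]; exact add_mem ha hb
  | mem j φ hφ =>
    induction hp using Submodule.iSup_induction' with
    | zero =>
      have : dualAct Q 0 φ = 0 := by ext; simp [dualAct]
      rw [this]; exact zero_mem _
    | add a b _ _ ha hb =>
      have : dualAct Q (a + b) φ = dualAct Q a φ + dualAct Q b φ := by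
        ext; simp [dualAct, add_mul]
      rw [this]; exact add_mem ha hb
    | mem i p hp =>
      exact Submodule.mem_iSup_of_mem (i + j) (dualAct_mem_piece hmul i j p hp φ hφ)

/-- The `P`-module structure of the graded dual. -/
abbrev gradedDualModule (hG : DirectSum.IsInternal G)
    (hmul : ∀ i j : ℤ, ∀ a ∈ G i, ∀ b ∈ G j, a * b ∈ G (i + j))
    (R : Type*) [CommRing R] [Algebra Q R] [Algebra R P] :
    Module P (GradedDual G R) where
  smul p φ := ⟨dualAct Q p φ.1, dualAct_mem hG hmul p φ.1 φ.2⟩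
  one_smul φ := Subtype.ext (LinearMap.ext fun q => congrArg φ.1 (one_mul q))
  mul_smul p p' φ := Subtype.ext (LinearMap.ext fun q => congrArg φ.1
    ((mul_assoc p p' q).trans (mul_left_comm p p' q)))
  smul_zero p := Subtype.ext (map_zero (dualAct Q p))
  smul_add p φ ψ := Subtype.ext (map_add (dualAct Q p) φ.1 ψ.1)
  add_smul p p' φ := Subtype.ext (LinearMap.ext fun q =>
    (congrArg φ.1 (add_mul p p' q)).trans (map_add φ.1 _ _))
  zero_smul φ := Subtype.ext (LinearMap.ext fun q =>
    (congrArg φ.1 (zero_mul q)).trans (map_zero φ.1))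

theorem isInternal_gradedDual (hG : DirectSum.IsInternal G)
    (R : Type*) [CommRing R] [Algebra Q R] [Algebra R P] :
    DirectSum.IsInternal (gradedDualPiece G R) := by
  have h1 : ⨆ j, gradedDualPiece G R j = ⊤ := by
    rw [eq_top_iff]
    rintro ⟨φ, hφ⟩ -
    have hφ' : φ ∈ ⨆ j, dualPiece G R j := hφ
    induction hφ' using Submodule.iSup_induction' with
    | zero => exact zero_mem (⨆ j, gradedDualPiece G R j)
    | add a b ha hb iha ihb =>
      exact add_mem (S := Submodule Q (GradedDual G R)) (iha ha) (ihb hb)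
    | mem j φ hj => exact Submodule.mem_iSup_of_mem (p := gradedDualPiece G R) j hj
  let c : ∀ j, GradedDual G R →ₗ[Q] (G (-j) → R) := fun j =>
    { toFun := fun φ p => φ.1 p.1
      map_add' := fun _ _ => rfl
      map_smul' := fun _ _ => rfl }
  refine isInternal_of_detect (gradedDualPiece G R) h1 c ?_ ?_
  · intro i j h φ hφ
    funext p
    exact hφ (-i) (by simpa using Ne.symm h) p.1 p.2
  · intro j φ hφ h
    refine Subtype.ext (LinearMap.ext fun p => ?_)
    have hp : p ∈ ⨆ i, G i := by
      rw [hG.submodule_iSup_eq_top]; trivial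
    change φ.1 p = 0
    induction hp using Submodule.iSup_induction' with
    | zero => rw [map_zero]
    | add a b _ _ ha hb => rw [map_add, ha, hb, add_zero]
    | mem i p hp =>
      by_cases hi : i = -j
      · subst hi
        exact congrFun h ⟨p, hp⟩
      · exact hφ i hi p hp

theorem dualPiece_odd (hG : DirectSum.IsInternal G)
    (hodd : ∀ i : ℤ, Odd i → G i = ⊥) (j : ℤ) (hj : Odd j) (φ : P →ₗ[R] R)
    (hφ : φ ∈ dualPiece G R j) : φ = 0 := by
  ext p
  have hp : p ∈ ⨆ i, G i := by
    rw [hG.submodule_iSup_eq_top]; trivial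
  induction hp using Submodule.iSup_induction' with
  | zero => simp
  | add a b _ _ ha hb => rw [map_add, map_add, ha, hb]
  | mem i p hp =>
    by_cases h : i = -j
    · rw [hodd i (h ▸ hj.neg), Submodule.mem_bot] at hp
      simp [hp]
    · exact hφ i h p hp

end GradedDual

/-! ### The polynomial ring `P = R[χ_1, …, χ_n]` and its graded dual, for `R = Q/I` -/

section Polynomial

variable {Q : Type u} [CommRing Q] (I : Ideal Q) (n : ℕ)

/-- The grading of `R[χ_1, …, χ_n]` with `|χ_i| = -2`. -/
def polyGrading (i : ℤ) : Submodule Q (MvPolynomial (Fin n) (Q ⧸ I)) :=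
  (MvPolynomial.weightedHomogeneousSubmodule (Q ⧸ I)
    (fun _ : Fin n => (-2 : ℤ)) i).restrictScalars Q

theorem isInternal_polyGrading : DirectSum.IsInternal (polyGrading I n) := by
  let := MvPolynomial.weightedGradedAlgebra (Q ⧸ I) (fun _ : Fin n => (-2 : ℤ))
  exact DirectSum.Decomposition.isInternal
    (MvPolynomial.weightedHomogeneousSubmodule (Q ⧸ I) (fun _ : Fin n => (-2 : ℤ)))

theorem polyGrading_mul_mem (i j : ℤ) (a : MvPolynomial (Fin n) (Q ⧸ I))
    (ha : a ∈ polyGrading I n i) (b : MvPolynomial (Fin n) (Q ⧸ I))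
    (hb : b ∈ polyGrading I n j) : a * b ∈ polyGrading I n (i + j) :=
  MvPolynomial.IsWeightedHomogeneous.mul ha hb

theorem polyGrading_odd (i : ℤ) (hi : Odd i) : polyGrading I n i = ⊥ := by
  rw [eq_bot_iff]
  intro p hp
  rw [Submodule.mem_bot]
  ext m
  by_contra hm
  have h := (hp : MvPolynomial.IsWeightedHomogeneous _ p i) hm
  rw [Finsupp.weight_apply, Finsupp.sum] at h
  rw [← h, ← Int.not_even_iff_odd] at hi
  exact hi (Finset.even_sum _ fun k _ => by simp)

/-- `P = R[χ_1, …, χ_n]`, as a DG `Q`-algebra with zero differential and `|χ_i| = -2`. -/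
def polyDG : DGAlgebra Q where
  carrier := MvPolynomial (Fin n) (Q ⧸ I)
  gr := polyGrading I n
  internal := isInternal_polyGrading I n
  one_mem := MvPolynomial.isWeightedHomogeneous_one _ _
  mul_mem := polyGrading_mul_mem I n
  graded_comm i j a ha b hb := by
    rcases Int.even_or_odd i with hi | hi
    · rw [Int.negOnePow_even _ (hi.mul_right _), one_smul, mul_comm]
    · rw [polyGrading_odd I n i hi, Submodule.mem_bot] at ha
      simp [ha]
  d := 0
  d_mem _ _ _ := zero_mem _
  d_d _ := rfl
  leibniz := by simp

theorem polyDG_isEven : (polyDG I n).IsEven := polyGrading_odd I n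

/-- The variable `χ_i`. -/
def chi (i : Fin n) : polyDG I n := (MvPolynomial.X i : MvPolynomial (Fin n) (Q ⧸ I))

/-- The graded dual `D = Hom_R(P, R)`, as a DG `P`-module with zero differential. -/
def dualDG : DGModule (polyDG I n) :=
  letI : Module (polyDG I n) (GradedDual (polyGrading I n) (Q ⧸ I)) :=
    gradedDualModule (isInternal_polyGrading I n) (polyGrading_mul_mem I n) (Q ⧸ I)
  haveI : IsScalarTower Q (polyDG I n) (GradedDual (polyGrading I n) (Q ⧸ I)) := ⟨fun q p φ =>
    Subtype.ext (LinearMap.ext fun r =>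
      (congrArg φ.1 (smul_mul_assoc (β := MvPolynomial (Fin n) (Q ⧸ I)) q p r)).trans
        (LinearMap.map_smul_of_tower φ.1 q _))⟩
  { carrier := GradedDual (polyGrading I n) (Q ⧸ I)
    gr := gradedDualPiece (polyGrading I n) (Q ⧸ I)
    internal := isInternal_gradedDual (isInternal_polyGrading I n) (Q ⧸ I)
    smul_mem := fun i j p hp φ hφ =>
      dualAct_mem_piece (polyGrading_mul_mem I n) i j p hp φ.1 hφ
    d := 0
    d_mem := fun _ _ _ => zero_mem _
    d_d := fun _ => rfl
    leibniz := fun i p _ φ => by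
      have h1 : (polyDG I n).d p • φ = 0 := zero_smul (polyDG I n) φ
      rw [h1, LinearMap.zero_apply, LinearMap.zero_apply, smul_zero, smul_zero, add_zero] }

theorem dualDG_isEven : (dualDG I n).IsEven := by
  intro j hj
  rw [eq_bot_iff]
  intro φ hφ
  exact Subtype.ext
    (dualPiece_odd (isInternal_polyGrading I n) (polyGrading_odd I n) j hj φ.1 hφ)

/-- `I` annihilates `D`. -/
theorem dualDG_smul_eq_zero (q : Q) (hq : q ∈ I) (φ : dualDG I n) : q • φ = 0 := by
  refine Subtype.ext (LinearMap.ext fun p => ?_)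
  change q • (φ.1 p) = 0
  rw [Algebra.smul_def, Ideal.Quotient.algebraMap_eq, Ideal.Quotient.eq_zero_iff_mem.mpr hq,
    zero_mul]

end Polynomial

/-! ### The perturbations `(D ⊗ F)^δ` -/

section Perturbation

variable {Q : Type u} [CommRing Q]

/-- `∑_i χ_i ⊗ a_i` as an endomorphism of `D ⊗_Q X`, where `a_i ∈ A` acts on `X` by left
multiplication. -/
def chiSum (I : Ideal Q) (n : ℕ) {A : DGAlgebra Q} (X : DGModule A) (a : Fin n → A) :
    (dualDG I n) ⊗[Q] X →ₗ[Q] (dualDG I n) ⊗[Q] X :=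
  ∑ i, TensorProduct.map (Algebra.lsmul Q Q (dualDG I n) (chi I n i)) (Algebra.lsmul Q Q X (a i))

theorem chiSum_eq (I : Ideal Q) (n : ℕ) {A : DGAlgebra Q} (X : DGModule A) (a : Fin n → A) :
    chiSum I n X a = (dualDG I n).tensorAction X (∑ i, chi I n i ⊗ₜ a i) := by
  rw [map_sum]
  rfl

theorem sum_sq_eq_zero {S ι : Type*} [Ring S] (s : Finset ι) (w : ι → S)
    (h0 : ∀ i, w i * w i = 0) (h : ∀ i j, w i * w j + w j * w i = 0) :
    (∑ i ∈ s, w i) * (∑ i ∈ s, w i) = 0 := by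
  classical
  induction s using Finset.induction_on with
  | empty => simp
  | insert i s hi ih =>
    have : w i * (∑ j ∈ s, w j) + (∑ j ∈ s, w j) * w i = 0 := by
      rw [Finset.mul_sum, Finset.sum_mul, ← Finset.sum_add_distrib]
      exact Finset.sum_eq_zero fun j _ => h i j
    rw [Finset.sum_insert hi, add_mul, mul_add, mul_add, h0, ih, zero_add, add_zero, this]

theorem chi_mem (I : Ideal Q) (n : ℕ) (i : Fin n) : chi I n i ∈ (polyDG I n).gr (-2) :=
  MvPolynomial.isWeightedHomogeneous_X _ _ _

variable (I : Ideal Q) (n : ℕ) {A : DGAlgebra Q} (X : DGModule A) (a : Fin n → A)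

theorem chiElt_mem (h1 : ∀ i, a i ∈ A.gr 1) :
    (∑ i, chi I n i ⊗ₜ[Q] a i : polyDG I n ⊗[Q] A) ∈ tensorGrading (polyDG I n).gr A.gr (-1) :=
  Submodule.sum_mem _ fun i _ => Submodule.subset_span
    ⟨-2, 1, by norm_num, chi I n i, chi_mem I n i, a i, h1 i, rfl⟩

theorem chiElt_sq (h1 : ∀ i, a i ∈ A.gr 1) (h2 : ∀ i, a i * a i = 0) :
    (∑ i, chi I n i ⊗ₜ[Q] a i : polyDG I n ⊗[Q] A) * (∑ i, chi I n i ⊗ₜ[Q] a i) = 0 := by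
  refine sum_sq_eq_zero _ _ (fun i => ?_) (fun i j => ?_)
  · rw [Algebra.TensorProduct.tmul_mul_tmul, h2, TensorProduct.tmul_zero]
  · rw [Algebra.TensorProduct.tmul_mul_tmul, Algebra.TensorProduct.tmul_mul_tmul,
      A.graded_comm 1 1 _ (h1 i) _ (h1 j), show chi I n i * chi I n j = chi I n j * chi I n i from
        mul_comm (G := MvPolynomial (Fin n) (Q ⧸ I)) _ _]
    simp [TensorProduct.tmul_neg]

theorem chiSum_isDegreeMap (h1 : ∀ i, a i ∈ A.gr 1) :
    DGModule.IsDegreeMap (DGModule.tensor (polyDG_isEven I n) (dualDG I n) (dualDG_isEven I n) X)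
      (DGModule.tensor (polyDG_isEven I n) (dualDG I n) (dualDG_isEven I n) X) (-1)
      (chiSum I n X a) := by
  rw [chiSum_eq]
  refine ⟨fun i x hx => ?_, fun j r hr x => ?_⟩
  · rw [add_comm]
    exact DGModule.tensorAction_mem (dualDG I n) X (-1) i _ (chiElt_mem I n a h1) x hx
  · exact DGModule.tensorAction_comm (dualDG I n) X _ r x _
      (((polyDG I n).tensor (polyDG_isEven I n) A).graded_comm (-1) j _
        (chiElt_mem I n a h1) r hr)

theorem chiSum_sq (h1 : ∀ i, a i ∈ A.gr 1) (h2 : ∀ i, a i * a i = 0)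
    (x : (dualDG I n) ⊗[Q] X) : chiSum I n X a (chiSum I n X a x) = 0 := by
  rw [chiSum_eq, ← Module.End.mul_apply, ← map_mul, chiElt_sq I n a h1 h2, map_zero,
    LinearMap.zero_apply]

theorem chiSum_cycle (q : Fin n → Q) (hq : ∀ i, q i ∈ I) (h1 : ∀ i, a i ∈ A.gr 1)
    (h3 : ∀ i, A.d (a i) = algebraMap Q A (q i)) (x : (dualDG I n) ⊗[Q] X) :
    X.d.lTensor (dualDG I n) (chiSum I n X a x) +
      chiSum I n X a (X.d.lTensor (dualDG I n) x) = 0 := by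
  induction x with
  | zero => simp
  | add x y hx hy =>
    simp only [map_add]
    rw [add_add_add_comm, hx, hy, add_zero]
  | tmul φ x =>
    simp only [chiSum, LinearMap.sum_apply, map_sum, TensorProduct.map_tmul,
      LinearMap.lTensor_tmul, ← Finset.sum_add_distrib, ← TensorProduct.tmul_add]
    refine Finset.sum_eq_zero fun i _ => ?_
    simp only [Algebra.lsmul_coe]
    rw [X.leibniz 1 _ (h1 i), h3, algebraMap_smul, Int.negOnePow_one, Units.neg_smul, one_smul,
      neg_add_cancel_right, ← TensorProduct.smul_tmul, dualDG_smul_eq_zero I n _ (hq i),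
      TensorProduct.zero_tmul]

/-- The DG `P ⊗_Q A`-module `(D ⊗_Q X)^δ` with `δ = ∑ χ_i ⊗ a_i`, for elements `a_i ∈ A_1` with
`a_i² = 0` and `∂a_i ∈ I`. -/
def perturbedDual (q : Fin n → Q) (hq : ∀ i, q i ∈ I) (h1 : ∀ i, a i ∈ A.gr 1)
    (h2 : ∀ i, a i * a i = 0) (h3 : ∀ i, A.d (a i) = algebraMap Q A (q i)) :
    DGModule ((polyDG I n).tensor (polyDG_isEven I n) A) :=
  (DGModule.tensor (polyDG_isEven I n) (dualDG I n) (dualDG_isEven I n) X).perturb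
    (chiSum I n X a) (chiSum_isDegreeMap I n X a h1) (chiSum_cycle I n X a q hq h1 h3)
    (chiSum_sq I n X a h1 h2)

end Perturbation

/-! ### `Λ`, `B` and strong `Λ`-resolutions -/

section Strong

variable {Q : Type u} [CommRing Q] {n : ℕ}

/-- `Λ = E ⊗_Q E'`, for the Koszul complexes `E` on `f` and `E'` on `f'`; this is the Koszul
complex `Q⟨ξ_i, ξ'_i | ∂ξ_i = f_i, ∂ξ'_i = f'_i⟩` on the concatenation of `f` and `f'`. -/
abbrev Lam (f f' : Fin n → Q) : DGAlgebra Q := koszul (Sum.elim f f')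

/-- `ξ_i ∈ Λ`. -/
abbrev xi (f f' : Fin n → Q) (i : Fin n) : Lam f f' := koszulGen (Sum.elim f f') (Sum.inl i)

/-- `ξ'_i ∈ Λ`. -/
abbrev xi' (f f' : Fin n → Q) (i : Fin n) : Lam f f' := koszulGen (Sum.elim f f') (Sum.inr i)

/-- `B = Λ⟨ζ_{i,j} | ∂ζ_{i,j} = g_{i,j}⟩`. -/
abbrev BAlg (f f' : Fin n → Q) {m : Fin n → ℕ} (g : ∀ i, Fin (m i) → Q) : DGAlgebra Q :=
  koszul (Sum.elim (Sum.elim f f') (fun p : Σ i, Fin (m i) => g p.1 p.2))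

/-- The inclusion `Λ → B`. -/
abbrev lamToB (f f' : Fin n → Q) {m : Fin n → ℕ} (g : ∀ i, Fin (m i) → Q) :
    DGAlgebra.Hom (Lam f f') (BAlg f f' g) :=
  koszulInl (Sum.elim f f') (fun p : Σ i, Fin (m i) => g p.1 p.2)

theorem BAlg_annihilates (f f' : Fin n → Q) {m : Fin n → ℕ} (g : ∀ i, Fin (m i) → Q)
    (I : Ideal Q) (M : Type u) [AddCommGroup M] [Module Q M] [Module (Q ⧸ I) M]
    [IsScalarTower Q (Q ⧸ I) M] (hf : ∀ i, f i ∈ I) (hf' : ∀ i, f' i ∈ I)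
    (hg : ∀ i j, g i j ∈ Module.annihilator Q M) (k) :
    Sum.elim (Sum.elim f f') (fun p : Σ i, Fin (m i) => g p.1 p.2) k ∈
      Module.annihilator Q M := by
  have hI : I ≤ Module.annihilator Q M := by
    intro q hq
    rw [Module.mem_annihilator]
    intro x
    rw [← algebraMap_smul (Q ⧸ I), Ideal.Quotient.algebraMap_eq,
      Ideal.Quotient.eq_zero_iff_mem.mpr hq, zero_smul]
  rcases k with (i | i) | p
  · exact hI (hf i)
  · exact hI (hf' i)
  · exact hg p.1 p.2

/-- A strong `Λ`-resolution of the `R`-module `M`, `R = Q/I`: expressions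
`f_i - f'_i = ∑_j x_{i,j} g_{i,j}` with `x_{i,j} ∈ I` and `g_{i,j} ∈ ann_Q(M)`, and a bounded below
semiprojective resolution `F → M` over `B = Λ⟨ζ_{i,j} | ∂ζ_{i,j} = g_{i,j}⟩`. -/
structure StrongResolution (I : Ideal Q) (f f' : Fin n → Q) (hf : ∀ i, f i ∈ I)
    (hf' : ∀ i, f' i ∈ I) (M : Type u) [AddCommGroup M] [Module Q M] [Module (Q ⧸ I) M]
    [IsScalarTower Q (Q ⧸ I) M] where
  m : Fin n → ℕ
  x : ∀ i, Fin (m i) → Q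
  g : ∀ i, Fin (m i) → Q
  x_mem : ∀ i j, x i j ∈ I
  g_mem : ∀ i j, g i j ∈ Module.annihilator Q M
  sum_eq : ∀ i, f i - f' i = ∑ j, x i j * g i j
  F : DGModule (BAlg f f' g)
  boundedBelow : F.BoundedBelow
  semiprojective : F.IsSemiprojective
  aug : DGModule.Hom F (koszulModule _ M (BAlg_annihilates f f' g I M hf hf' g_mem))
  aug_surjective : Function.Surjective aug.map
  aug_quasiIso : aug.IsQuasiIso

variable {I : Ideal Q} {f f' : Fin n → Q} {hf : ∀ i, f i ∈ I} {hf' : ∀ i, f' i ∈ I}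
  {M : Type u} [AddCommGroup M] [Module Q M] [Module (Q ⧸ I) M] [IsScalarTower Q (Q ⧸ I) M]

/-- `F`, as a DG `Λ`-module. -/
abbrev StrongResolution.FLam (S : StrongResolution I f f' hf hf' M) : DGModule (Lam f f') :=
  S.F.restrictScalars (lamToB f f' S.g)

/-- The DG `P ⊗_Q Λ`-module `(D ⊗_Q F)^δ`, `δ = ∑ χ_i ⊗ λ_i`, where `λ_i` is left multiplication
by `ξ_i`. -/
def StrongResolution.perturbDelta (S : StrongResolution I f f' hf hf' M) :
    DGModule ((polyDG I n).tensor (polyDG_isEven I n) (Lam f f')) :=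
  perturbedDual I n S.FLam (fun i => xi f f' i) f hf
    (fun _ => koszulGen_mem _ _) (fun _ => koszulGen_sq _ _) (fun _ => koszulGen_d _ _)

/-- The DG `P ⊗_Q Λ`-module `(D ⊗_Q F)^ε`, `ε = ∑ χ_i ⊗ λ'_i`, where `λ'_i` is left multiplication
by `ξ'_i`. -/
def StrongResolution.perturbEpsilon (S : StrongResolution I f f' hf hf' M) :
    DGModule ((polyDG I n).tensor (polyDG_isEven I n) (Lam f f')) :=
  perturbedDual I n S.FLam (fun i => xi' f f' i) f' hf'
    (fun _ => koszulGen_mem _ _) (fun _ => koszulGen_sq _ _) (fun _ => koszulGen_d _ _)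

end Strong

end

/-! ### Locally finite sums and locally nilpotent perturbations of the identity -/

section Linear

variable {Q : Type*} [CommRing Q] {V W : Type*} [AddCommGroup V] [Module Q V]
  [AddCommGroup W] [Module Q W]

/-! In `B` put w_i = ξ_i - ξ'_i - ∑_j x_{i,j} ζ_{i,j}. This is an element of degree 1 with w_i² = 0
and ∂w_i = f_i - f'_i - ∑_j x_{i,j} g_{i,j} = 0, and it acts as zero on M. Since every x_{i,j} lies
in I and I kills D, the ζ-terms vanish on D ⊗ F, so that δ - ε = ∑ χ_i ⊗ w_i there
(`StrongResolution.tmul_cycle_smul`). The task is to remove this difference by a change of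
coordinates.

Because F → M is a semiprojective resolution over `B`, a cycle of odd degree in Hom_B(F, F) whose
image lies in the kernel of F → M is a boundary (`IsSemiprojective.exists_boundary`). Applied
recursively, starting from w_i itself, this yields B-linear operators σ_k of degree 2k with σ_0 = 1
and [∂, σ_{k+1}] = w_i σ_k (`IsSemiprojective.exists_homotopies`). They play the role of the divided
powers σ^k/k! of a null-homotopy σ of w_i, without any division and without w_i and σ having to
commute.

The operator Φ = ∑_k χ_i^k ⊗ σ_k then stands for exp(χ_i ⊗ σ). The sum is finite on each element
because χ_i is locally nilpotent on D. The relations for the σ_k say that [∂, Φ] = (χ_i ⊗ w_i) Φ;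
since Φ is also P ⊗ Λ-linear, it carries a perturbation containing χ_i ⊗ λ_i to the one with χ_i ⊗
λ'_i in its place. It is bijective because 1 - Φ is locally nilpotent
(`nonempty_iso_perturbedDual_of_eq_off`). Exchanging the indices one at a time and composing gives
the theorem; the operators belonging to different i need not commute. -/

theorem finsum_eq_sum_range_of_vanish (u : ℕ → W) (N : ℕ) (h : ∀ k, N ≤ k → u k = 0) :
    ∑ᶠ k, u k = ∑ k ∈ Finset.range N, u k := by
  refine finsum_eq_sum_of_support_subset _ fun k hk => ?_
  by_contra hk'
  exact hk (h k (by simpa using hk'))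

/-- The sum of a sequence of linear maps of which only finitely many are nonzero on each vector. -/
noncomputable def locallyFiniteSum (u : ℕ → V →ₗ[Q] W)
    (hu : ∀ v, ∃ N, ∀ k, N ≤ k → u k v = 0) : V →ₗ[Q] W where
  toFun v := ∑ᶠ k, u k v
  map_add' v v' := by
    obtain ⟨N, hN⟩ := hu v
    obtain ⟨N', hN'⟩ := hu v'
    have h : ∀ k, max N N' ≤ k → u k v = 0 := fun k hk => hN k (le_trans (le_max_left _ _) hk)
    have h' : ∀ k, max N N' ≤ k → u k v' = 0 := fun k hk => hN' k (le_trans (le_max_right _ _) hk)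
    rw [finsum_eq_sum_range_of_vanish _ _ h, finsum_eq_sum_range_of_vanish _ _ h',
      finsum_eq_sum_range_of_vanish _ (max N N') (fun k hk => by rw [map_add, h k hk, h' k hk,
        add_zero]), ← Finset.sum_add_distrib]
    simp only [map_add]
  map_smul' q v := by
    obtain ⟨N, hN⟩ := hu v
    rw [finsum_eq_sum_range_of_vanish _ _ hN,
      finsum_eq_sum_range_of_vanish _ N (fun k hk => by rw [map_smul, hN k hk, smul_zero]),
      RingHom.id_apply, Finset.smul_sum]
    simp only [map_smul]

theorem locallyFiniteSum_apply (u : ℕ → V →ₗ[Q] W) (hu : ∀ v, ∃ N, ∀ k, N ≤ k → u k v = 0)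
    (v : V) (N : ℕ) (h : ∀ k, N ≤ k → u k v = 0) :
    locallyFiniteSum u hu v = ∑ k ∈ Finset.range N, u k v :=
  finsum_eq_sum_range_of_vanish _ _ h

theorem locallyFiniteSum_mem (u : ℕ → V →ₗ[Q] W) (hu : ∀ v, ∃ N, ∀ k, N ≤ k → u k v = 0)
    (v : V) (G : Submodule Q W) (h : ∀ k, u k v ∈ G) : locallyFiniteSum u hu v ∈ G := by
  obtain ⟨N, hN⟩ := hu v
  rw [locallyFiniteSum_apply u hu v N hN]
  exact Submodule.sum_mem _ fun k _ => h k

theorem locallyFiniteSum_comm (u : ℕ → V →ₗ[Q] V) (hu : ∀ v, ∃ N, ∀ k, N ≤ k → u k v = 0)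
    (c : V →ₗ[Q] V) (h : ∀ k v, u k (c v) = c (u k v)) (v : V) :
    locallyFiniteSum u hu (c v) = c (locallyFiniteSum u hu v) := by
  obtain ⟨N, hN⟩ := hu v
  rw [locallyFiniteSum_apply u hu v N hN,
    locallyFiniteSum_apply u hu (c v) N (fun k hk => by rw [h, hN k hk, map_zero]), map_sum]
  exact Finset.sum_congr rfl fun k _ => h k v

/-- The relation [d, u_{k+1}] = c u_k shifts the index by one, so summing over k reproduces the
whole series: [d, ∑ u_k] = c ∑ u_k. This is the differential equation of the exponential. -/
theorem locallyFiniteSum_commutator (u : ℕ → V →ₗ[Q] V)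
    (hu : ∀ v, ∃ N, ∀ k, N ≤ k → u k v = 0) (d c : V →ₗ[Q] V)
    (h0 : ∀ v, d (u 0 v) = u 0 (d v)) (h : ∀ k v, d (u (k + 1) v) - u (k + 1) (d v) = c (u k v))
    (v : V) :
    d (locallyFiniteSum u hu v) = locallyFiniteSum u hu (d v) + c (locallyFiniteSum u hu v) := by
  obtain ⟨N, hN⟩ := hu v
  obtain ⟨N', hN'⟩ := hu (d v)
  set K := max N N'
  have hK : ∀ k, K ≤ k → u k v = 0 := fun k hk => hN k (le_trans (le_max_left _ _) hk)
  have hK' : ∀ k, K ≤ k → u k (d v) = 0 := fun k hk => hN' k (le_trans (le_max_right _ _) hk)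
  -- The two sums under or after d are cut at K + 1 and the one under c at K: once the term k = 0 is
  -- split off, all three run over the same range.
  rw [locallyFiniteSum_apply u hu (d v) (K + 1) fun k hk => hK' k (by omega)]
  conv_lhs => rw [locallyFiniteSum_apply u hu v (K + 1) fun k hk => hK k (by omega)]
  rw [locallyFiniteSum_apply u hu v K hK, map_sum, map_sum, Finset.sum_range_succ',
    Finset.sum_range_succ', h0, add_right_comm, ← Finset.sum_add_distrib]
  congr 1
  exact Finset.sum_congr rfl fun k _ => by rw [← h]; abel

/-- On the kernel of Φ the operator 1 - Φ is the identity, so it can be nilpotent there only on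
zero. -/
theorem injective_of_locallyNilpotent (Φ : Module.End Q V)
    (hnil : ∀ v, ∃ m : ℕ, ((1 - Φ) ^ m) v = 0) : Function.Injective Φ := by
  refine (injective_iff_map_eq_zero Φ).mpr fun v hv => ?_
  obtain ⟨m, hm⟩ := hnil v
  have h1 : (1 - Φ) v = v := by simp [hv]
  have h2 : ∀ m : ℕ, ((1 - Φ) ^ m) v = v := by
    intro m
    induction m with
    | zero => rfl
    | succ m ih => rw [pow_succ, Module.End.mul_apply, h1, ih]
  rw [← h2 m, hm]

/-- The geometric series in 1 - Φ inverts Φ, and it is a finite sum on each vector. It preserves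
every Φ-stable submodule; with G a graded piece this gives surjectivity in each degree. -/
theorem exists_mem_eq_of_locallyNilpotent (Φ : Module.End Q V)
    (hnil : ∀ v, ∃ m : ℕ, ((1 - Φ) ^ m) v = 0) (G : Submodule Q V) (hG : ∀ v ∈ G, Φ v ∈ G)
    (v : V) (hv : v ∈ G) : ∃ v' ∈ G, Φ v' = v := by
  obtain ⟨m, hm⟩ := hnil v
  refine ⟨(∑ l ∈ Finset.range m, (1 - Φ) ^ l) v, ?_, ?_⟩
  · rw [LinearMap.sum_apply]
    refine Submodule.sum_mem _ fun l hl => ?_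
    clear hl
    induction l with
    | zero => exact hv
    | succ l ih =>
      rw [pow_succ', Module.End.mul_apply]
      exact sub_mem ih (hG _ ih)
  · have := mul_neg_geom_sum (1 - Φ) m
    rw [sub_sub_cancel] at this
    rw [← Module.End.mul_apply, this, LinearMap.sub_apply, hm, sub_zero, Module.End.one_apply]

end Linear

/-! ### The operator `∑ pᵏ ⊗ σ_k` -/

section TensorSeries

variable {Q : Type*} [CommRing Q] {T V : Type*} [AddCommGroup T] [Module Q T]
  [AddCommGroup V] [Module Q V]

/-- On a pure tensor the bound depends only on the left factor, so nothing is required of the σ_k.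
-/
theorem exists_vanish_tensorSeries (p : Module.End Q T) (hp : ∀ t, ∃ N, (p ^ N) t = 0)
    (σ : ℕ → Module.End Q V) (z : T ⊗[Q] V) :
    ∃ N, ∀ k, N ≤ k → TensorProduct.map (p ^ k) (σ k) z = 0 := by
  induction z with
  | zero => exact ⟨0, fun k _ => map_zero _⟩
  | add z z' h h' =>
    obtain ⟨N, hN⟩ := h
    obtain ⟨N', hN'⟩ := h'
    exact ⟨max N N', fun k hk => by
      rw [map_add, hN k (le_trans (le_max_left _ _) hk), hN' k (le_trans (le_max_right _ _) hk),
        add_zero]⟩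
  | tmul t v =>
    obtain ⟨N, hN⟩ := hp t
    refine ⟨N, fun k hk => ?_⟩
    rw [TensorProduct.map_tmul, ← Nat.sub_add_cancel hk, pow_add, Module.End.mul_apply, hN,
      map_zero, TensorProduct.zero_tmul]

/-- The operator `∑ pᵏ ⊗ σ_k` on `T ⊗ V`, for a locally nilpotent endomorphism `p` of `T`. -/
noncomputable def tensorSeries (p : Module.End Q T) (hp : ∀ t, ∃ N, (p ^ N) t = 0)
    (σ : ℕ → Module.End Q V) : Module.End Q (T ⊗[Q] V) :=
  locallyFiniteSum (fun k => TensorProduct.map (p ^ k) (σ k)) (exists_vanish_tensorSeries p hp σ)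

/-- If `σ_0 = 1`, then `∑ pᵏ ⊗ σ_k` is the identity up to a locally nilpotent operator. -/
theorem tensorSeries_locallyNilpotent (p : Module.End Q T) (hp : ∀ t, ∃ N, (p ^ N) t = 0)
    (σ : ℕ → Module.End Q V) (h0 : σ 0 = 1) (z : T ⊗[Q] V) :
    ∃ m : ℕ, ((1 - tensorSeries p hp σ) ^ m) z = 0 := by
  -- The exponent that kills t also kills t ⊗ v under 1 - Φ, by induction: since σ_0 = 1, (1 - Φ)(t
  -- ⊗ v) involves only the terms p^{k+1} t ⊗ σ_{k+1} v, and p^{k+1} t is already killed by p^m.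
  have key : ∀ m t v, (p ^ m) t = 0 →
      ((1 - tensorSeries p hp σ) ^ m) (t ⊗ₜ[Q] v) = 0 := by
    intro m
    induction m with
    | zero =>
      intro t v ht
      rw [show t = 0 from ht, TensorProduct.zero_tmul, map_zero]
    | succ m ih =>
      intro t v ht
      have hv : ∀ k, m + 1 ≤ k → TensorProduct.map (p ^ k) (σ k) (t ⊗ₜ[Q] v) = 0 := by
        intro k hk
        rw [TensorProduct.map_tmul, ← Nat.sub_add_cancel hk, pow_add, Module.End.mul_apply, ht,
          map_zero, TensorProduct.zero_tmul]
      have hs : tensorSeries p hp σ (t ⊗ₜ[Q] v) =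
          ∑ k ∈ Finset.range (m + 1), TensorProduct.map (p ^ k) (σ k) (t ⊗ₜ[Q] v) :=
        locallyFiniteSum_apply _ _ _ (m + 1) hv
      rw [pow_succ, Module.End.mul_apply, LinearMap.sub_apply, hs, Finset.sum_range_succ', h0]
      simp only [TensorProduct.map_tmul, pow_zero, Module.End.one_apply]
      rw [sub_add_cancel_right, map_neg, map_sum, neg_eq_zero]
      refine Finset.sum_eq_zero fun k _ => ih _ _ ?_
      rw [← Module.End.mul_apply, ← pow_add, show m + (k + 1) = k + (m + 1) by omega, pow_add,
        Module.End.mul_apply, ht, map_zero]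
  induction z with
  | zero => exact ⟨0, map_zero _⟩
  | add z z' h h' =>
    obtain ⟨m, hm⟩ := h
    obtain ⟨m', hm'⟩ := h'
    refine ⟨m + m', ?_⟩
    rw [map_add, pow_add, Module.End.mul_apply, Module.End.mul_apply, hm', map_zero, add_zero,
      ← Module.End.mul_apply, ← pow_add, add_comm, pow_add, Module.End.mul_apply, hm, map_zero]
  | tmul t v =>
    obtain ⟨m, hm⟩ := hp t
    exact ⟨m, key m t v hm⟩

end TensorSeries

/-! ### DG modules: isomorphisms, odd shifts, and null-homotopic odd cycles -/

namespace DGModule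

variable {Q : Type u} [CommRing Q] {A : DGAlgebra Q}

/-- The identity isomorphism. -/
def Iso.refl (X : DGModule A) : Iso X X where
  hom := ⟨LinearMap.id, ⟨fun i x hx => by simpa using hx, fun j a _ x => by simp⟩, fun _ => rfl⟩
  inv := ⟨LinearMap.id, ⟨fun i x hx => by simpa using hx, fun j a _ x => by simp⟩, fun _ => rfl⟩
  hom_inv _ := rfl
  inv_hom _ := rfl

/-- Composition of morphisms. -/
def Hom.comp {X Y Z : DGModule A} (β : Hom Y Z) (α : Hom X Y) : Hom X Z where
  map := β.map ∘ₗ α.map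
  isDegreeMap := ⟨fun i x hx => by
      have := β.isDegreeMap.1 _ _ (α.isDegreeMap.1 i x hx)
      rwa [add_zero] at this, fun j a ha x => by
      rw [LinearMap.comp_apply, LinearMap.comp_apply, α.isDegreeMap.2 j a ha,
        zero_mul, Int.negOnePow_zero, one_smul, one_smul, β.isDegreeMap.2 j a ha, zero_mul,
        Int.negOnePow_zero, one_smul]⟩
  comm x := by simp only [LinearMap.comp_apply, α.comm, β.comm]

/-- Composition of isomorphisms. -/
def Iso.trans {X Y Z : DGModule A} (e : Iso X Y) (e' : Iso Y Z) : Iso X Z where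
  hom := e'.hom.comp e.hom
  inv := e.inv.comp e'.inv
  hom_inv x := by simp only [Hom.comp, LinearMap.comp_apply, e'.hom_inv, e.hom_inv]
  inv_hom x := by simp only [Hom.comp, LinearMap.comp_apply, e'.inv_hom, e.inv_hom]

theorem mem_iSup_gr (X : DGModule A) (x : X) : x ∈ ⨆ i, X.gr i := by
  rw [X.internal.submodule_iSup_eq_top]; trivial

/-- An injective morphism that is surjective in each degree is an isomorphism. -/
theorem Hom.nonempty_iso {X Y : DGModule A} (α : Hom X Y) (hinj : Function.Injective α.map)
    (hsurj : ∀ i, ∀ y ∈ Y.gr i, ∃ x ∈ X.gr i, α.map x = y) : Nonempty (Iso X Y) := by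
  have hs : Function.Surjective α.map := by
    intro y
    induction Y.mem_iSup_gr y using Submodule.iSup_induction' with
    | zero => exact ⟨0, map_zero _⟩
    | add a b _ _ ha hb =>
      obtain ⟨x, rfl⟩ := ha
      obtain ⟨x', rfl⟩ := hb
      exact ⟨x + x', map_add _ _ _⟩
    | mem i y hy =>
      obtain ⟨x, _, h⟩ := hsurj i y hy
      exact ⟨x, h⟩
  let e := LinearEquiv.ofBijective α.map ⟨hinj, hs⟩
  have he : ∀ x, e x = α.map x := fun _ => rfl
  refine ⟨⟨α, ⟨e.symm.toLinearMap, ⟨fun i y hy => ?_, fun j a ha y => ?_⟩, fun y => ?_⟩,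
    e.symm_apply_apply, e.apply_symm_apply⟩⟩
  · obtain ⟨x, hx, rfl⟩ := hsurj i y hy
    rw [← he, LinearEquiv.coe_coe, e.symm_apply_apply, add_zero]
    exact hx
  · obtain ⟨x, rfl⟩ := e.surjective y
    rw [LinearEquiv.coe_coe, e.symm_apply_apply, LinearEquiv.symm_apply_eq, he, he, zero_mul,
      Int.negOnePow_zero, one_smul, α.isDegreeMap.2 j a ha, zero_mul,
      Int.negOnePow_zero, one_smul]
  · obtain ⟨x, rfl⟩ := e.surjective y
    rw [LinearEquiv.coe_coe, e.symm_apply_apply, LinearEquiv.symm_apply_eq, he, he, α.comm]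

/-- An element of `Hom_A(X, Y)` of even degree is `A`-linear. -/
theorem IsDegreeMap.map_smul_of_even {X Y : DGModule A} {e : ℤ} {φ : X →ₗ[Q] Y}
    (h : IsDegreeMap X Y e φ) (he : Even e) (a : A) (x : X) : φ (a • x) = a • φ x := by
  have ha : a ∈ ⨆ i, A.gr i := by rw [A.internal.submodule_iSup_eq_top]; trivial
  induction ha using Submodule.iSup_induction' with
  | zero => simp
  | add a b _ _ ha hb => rw [add_smul, add_smul, map_add, ha, hb]
  | mem i a ha => rw [h.2 i a ha, Int.negOnePow_even _ (he.mul_right _), one_smul]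

theorem IsDegreeMap.sub {X Y : DGModule A} {e : ℤ} {φ ψ : X →ₗ[Q] Y}
    (h : IsDegreeMap X Y e φ) (h' : IsDegreeMap X Y e ψ) : IsDegreeMap X Y e (φ - ψ) :=
  ⟨fun i x hx => sub_mem (h.1 i x hx) (h'.1 i x hx), fun j a ha x => by
    rw [LinearMap.sub_apply, LinearMap.sub_apply, h.2 j a ha, h'.2 j a ha, smul_sub, smul_sub]⟩

/-- Stated on elements, the condition transfers to a shifted complex, whose homology is a different
quotient type because its differential has the opposite sign. -/
theorem Hom.isQuasiIso_iff {X Y : DGModule A} (α : Hom X Y) : α.IsQuasiIso ↔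
    (∀ x, X.d x = 0 → (∃ y, Y.d y = α.map x) → ∃ x', X.d x' = x) ∧
      ∀ y, Y.d y = 0 → ∃ x, X.d x = 0 ∧ ∃ y', Y.d y' = α.map x - y := by
  have hmk : ∀ x : LinearMap.ker X.d, α.homologyMap (Submodule.Quotient.mk x) =
      Submodule.Quotient.mk (α.cyclesMap x) := fun x => rfl
  refine and_congr ⟨fun h x hx ⟨y, hy⟩ => ?_, fun h => ?_⟩ ⟨fun h y hy => ?_, fun h y => ?_⟩
  · have : (Submodule.Quotient.mk ⟨x, hx⟩ : X.Homology) = 0 := by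
      apply h
      rw [hmk, map_zero, Submodule.Quotient.mk_eq_zero]
      exact ⟨y, hy⟩
    rw [Submodule.Quotient.mk_eq_zero] at this
    exact this
  · refine (injective_iff_map_eq_zero _).mpr fun x hx => ?_
    obtain ⟨⟨x, hx'⟩, rfl⟩ := Submodule.Quotient.mk_surjective _ x
    rw [hmk, Submodule.Quotient.mk_eq_zero] at hx
    rw [Submodule.Quotient.mk_eq_zero]
    exact h x hx' hx
  · obtain ⟨x, hx⟩ := h (Submodule.Quotient.mk ⟨y, hy⟩)
    obtain ⟨⟨x, hx'⟩, rfl⟩ := Submodule.Quotient.mk_surjective _ x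
    rw [hmk, Submodule.Quotient.eq] at hx
    exact ⟨x, hx', hx⟩
  · obtain ⟨⟨y, hy⟩, rfl⟩ := Submodule.Quotient.mk_surjective _ y
    obtain ⟨x, hx, hxy⟩ := h y hy
    refine ⟨Submodule.Quotient.mk ⟨x, hx⟩, ?_⟩
    rw [hmk, Submodule.Quotient.eq]
    exact hxy

/-- For `e` odd and `s` the automorphism `a ↦ (-1)^{|a|} a` of `A`, the shift of `X` with
`(oddShift X)_i = X_{i+e}`, differential `-∂` and action `(a, x) ↦ (-1)^{|a|} a x`. -/
def oddShift (s : A →ₐ[Q] A) (hs : ∀ i : ℤ, ∀ a ∈ A.gr i, s a = i.negOnePow • a) (e : ℤ)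
    (X : DGModule A) : DGModule A :=
  { carrier := X
    addCommGroup := X.addCommGroup
    module := X.module
    moduleAlg := Module.compHom X (s : A →+* A)
    tower := by
      let : Module A X := Module.compHom X (s : A →+* A)
      exact ⟨fun q a x => (congrArg (fun b => X.moduleAlg.smul b x) (map_smul s q a)).trans
        (X.tower.smul_assoc q (s a) x)⟩
    gr := fun i => X.gr (i + e)
    internal := by
      -- The decomposition of X is reindexed by i ↦ i - e.
      obtain ⟨c, hc⟩ := exists_coaction X.gr X.internal
      refine isInternal_of_coaction _ ?_
        ((Finsupp.lmapDomain X Q (fun i : ℤ => i - e)).comp c) fun i x hx => ?_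
      · rw [eq_top_iff]
        rintro x -
        have hle : ⨆ i, X.gr i ≤ ⨆ i, X.gr (i + e) := iSup_le fun i =>
          le_iSup_of_le (f := fun i => X.gr (i + e)) (i - e) (by rw [sub_add_cancel])
        exact hle (X.mem_iSup_gr x)
      · simp [hc _ x hx, Finsupp.mapDomain_single]
    smul_mem := fun i j a ha x hx => by
      have h : s a ∈ A.gr i := by
        rw [hs i a ha, Units.smul_def]
        exact zsmul_mem ha _
      have := X.smul_mem i (j + e) (s a) h x hx
      rwa [← add_assoc] at this
    d := -X.d
    d_mem := fun i x hx => by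
      have := X.d_mem _ x hx
      rw [add_sub_right_comm] at this
      exact neg_mem this
    d_d := fun x => by
      rw [LinearMap.neg_apply, LinearMap.neg_apply, map_neg, X.d_d, neg_zero, neg_zero]
    leibniz := fun i a ha x => by
      -- The twist contributes (-1)^(i-1) on ∂a but (-1)^i on a; the discrepancy is exactly the sign
      -- of the new differential.
      change -X.d (s a • x) = s (A.d a) • x + i.negOnePow • (s a • -X.d x)
      rw [hs i a ha, hs _ _ (A.d_mem i a ha), Int.negOnePow_sub, Int.negOnePow_one]
      simp only [Units.smul_def, smul_assoc, map_zsmul, X.leibniz i a ha, smul_neg, smul_add,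
        neg_add, mul_neg, mul_one, Units.val_neg, neg_smul] }

/-- Over a semiprojective `P`, a cycle of odd degree in `Hom_A(P, X)` that becomes zero under a
surjective quasi-isomorphism `X → Y` is a boundary. -/
theorem IsSemiprojective.exists_boundary {P X Y : DGModule A} (hP : P.IsSemiprojective)
    (s : A →ₐ[Q] A) (hs : ∀ i : ℤ, ∀ a ∈ A.gr i, s a = i.negOnePow • a)
    (γ : Hom X Y) (hγ : Function.Surjective γ.map) (hγ' : γ.IsQuasiIso) (e : ℤ) (he : Odd e)
    (ψ : P →ₗ[Q] X) (hψ : IsDegreeMap P X e ψ) (hcyc : ∀ x, ψ (P.d x) = -X.d (ψ x))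
    (hzero : ∀ x, γ.map (ψ x) = 0) :
    ∃ σ : P →ₗ[Q] X, IsDegreeMap P X (e + 1) σ ∧ ∀ x, X.d (σ x) - σ (P.d x) = ψ x := by
  let X' := X.oddShift s hs e
  let Y' := Y.oddShift s hs e
  let γ' : Hom X' Y' :=
    { map := γ.map
      isDegreeMap := ⟨fun i x hx => by
          have := γ.isDegreeMap.1 _ x hx
          rw [add_right_comm] at this
          exact this, fun j a ha x => by
          rw [zero_mul, Int.negOnePow_zero, one_smul]
          exact γ.isDegreeMap.map_smul_of_even Even.zero (s a) x⟩
      comm := fun x => (map_neg γ.map (X.d x)).trans (congrArg Neg.neg (γ.comm x)) }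
  -- Changing the sign of the differentials alters neither cycles nor boundaries; only the bounding
  -- elements are negated.
  have hqi : γ'.IsQuasiIso := by
    rw [Hom.isQuasiIso_iff] at hγ' ⊢
    have hX : ∀ x : X, X'.d x = -X.d x := fun _ => rfl
    have hY : ∀ y : Y, Y'.d y = -Y.d y := fun _ => rfl
    refine ⟨fun x hx ⟨y, hy⟩ => ?_, fun y hy => ?_⟩
    · obtain ⟨x', hx'⟩ := hγ'.1 x (neg_eq_zero.mp hx) ⟨-y, (map_neg Y.d y).trans hy⟩
      exact ⟨(-x' : X), by rw [hX, map_neg, neg_neg]; exact hx'⟩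
    · obtain ⟨x, hx, y', hy'⟩ := hγ'.2 y (neg_eq_zero.mp hy)
      exact ⟨x, neg_eq_zero.mpr hx, (-y' : Y), by rw [hY, map_neg, neg_neg]; exact hy'⟩
  let z : ∀ Z : DGModule A, Hom P Z := fun Z =>
    ⟨0, ⟨fun _ _ _ => zero_mem _, fun _ _ _ _ => by simp⟩, fun _ => by simp⟩
  -- The shift is designed so that ψ becomes a morphism: the twisted action absorbs the sign
  -- (-1)^(ej) = (-1)^j, and the negated differential turns anticommutation into commutation.
  let ψ' : Hom P X' :=
    { map := ψ
      isDegreeMap := ⟨fun i x hx => by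
          rw [add_zero]
          exact hψ.1 i x hx, fun j a ha x => by
          rw [zero_mul, Int.negOnePow_zero, one_smul]
          refine (hψ.2 j a ha x).trans ?_
          change _ = s a • ψ x
          have hej : (e * j).negOnePow = j.negOnePow := by
            rw [Int.negOnePow_eq_iff, ← sub_one_mul]
            exact (he.sub_odd odd_one).mul_right _
          rw [hs j a ha, hej]
          simp only [Units.smul_def, smul_assoc]⟩
      comm := hcyc }
  -- Both ψ and 0 lift the zero morphism P → Y'. Uniqueness compares each of them only with the
  -- chosen lift β, hence two homotopies τ and ρ, whose difference ρ - τ bounds ψ.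
  obtain ⟨β, -, hβ⟩ := hP X' Y' (z Y') γ' hγ hqi
  obtain ⟨τ, hτ, hτ'⟩ := hβ ψ' hzero
  obtain ⟨ρ, hρ, hρ'⟩ := hβ (z X') (fun _ => map_zero γ.map)
  -- For a map of degree 1 into the shift, its own sign (-1)^j cancels that of the twisted action.
  -- What remains is honest A-linearity, as the even degree e + 1 demands.
  have hdeg : ∀ τ : P →ₗ[Q] X, IsDegreeMap P X' 1 τ → IsDegreeMap P X (e + 1) τ := by
    intro τ hτ
    refine ⟨fun i x hx => ?_, fun j a ha x => ?_⟩
    · have : τ x ∈ X.gr (i + 1 + e) := hτ.1 i x hx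
      rwa [add_assoc, add_comm 1] at this
    · have : τ (a • x) = (1 * j).negOnePow • (s a • τ x) := hτ.2 j a ha x
      rw [this, hs j a ha, one_mul, Int.negOnePow_even _ (he.add_one.mul_right _), one_smul]
      simp only [Units.smul_def, smul_assoc]
      rw [smul_smul, ← Units.val_mul, Int.units_mul_self, Units.val_one, one_smul]
  refine ⟨(ρ : P →ₗ[Q] X) - (τ : P →ₗ[Q] X), (hdeg ρ hρ).sub (hdeg τ hτ), fun x => ?_⟩
  have h : ∀ a b c d r t : X, -a + b = r - t → -c + d = 0 - t → c - a - (d - b) = r := by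
    intro a b c d r t h1 h2
    rw [show c - a - (d - b) = (-a + b) - (-c + d) by abel, h1, h2]
    abel
  exact (congrArg (· - _) (map_sub X.d (ρ x) (τ x))).trans (h _ _ _ _ _ _ (hτ' x) (hρ' x))

end DGModule

/-! ### Higher homotopies over a semiprojective resolution. -/

namespace DGModule

variable {Q : Type u} [CommRing Q] {A : DGAlgebra Q}

theorem IsDegreeMap.restrictScalars {B : DGAlgebra Q} (θ : DGAlgebra.Hom A B) {X Y : DGModule B}
    {e : ℤ} {φ : X →ₗ[Q] Y} (h : IsDegreeMap X Y e φ) :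
    IsDegreeMap (X.restrictScalars θ) (Y.restrictScalars θ) e φ :=
  ⟨h.1, fun j a ha x => h.2 j (θ.map a) (θ.map_mem j a ha) x⟩

/-- For a semiprojective resolution `P → Y` and a cycle `w ∈ A_1` with `w² = 0` and `wY = 0`, there
are `σ_k ∈ Hom_A(P, P)_{2k}` with `σ_0 = 1` and `[∂, σ_{k+1}] = w σ_k`. -/
theorem IsSemiprojective.exists_homotopies {P Y : DGModule A} (hP : P.IsSemiprojective)
    (s : A →ₐ[Q] A) (hs : ∀ i : ℤ, ∀ a ∈ A.gr i, s a = i.negOnePow • a)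
    (γ : Hom P Y) (hγ : Function.Surjective γ.map) (hγ' : γ.IsQuasiIso)
    (w : A) (hw : w ∈ A.gr 1) (hww : w * w = 0) (hdw : A.d w = 0) (hwY : ∀ y : Y, w • y = 0) :
    ∃ σ : ℕ → Module.End Q P, σ 0 = 1 ∧ (∀ k : ℕ, IsDegreeMap P P (2 * k) (σ k)) ∧
      ∀ k x, P.d (σ (k + 1) x) - σ (k + 1) (P.d x) = w • σ k x := by
  -- The invariant w[∂, σ] = 0 is precisely what makes wσ a cycle, as ∂w = 0. The map wσ has odd
  -- degree 2k + 1 and composes to zero with γ because w kills Y, so it bounds some σ'.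
  have step : ∀ (k : ℕ) (σ : Module.End Q P), IsDegreeMap P P (2 * k) σ →
      (∀ x, w • P.d (σ x) = w • σ (P.d x)) →
      ∃ σ' : Module.End Q P, IsDegreeMap P P (2 * (k + 1 : ℕ)) σ' ∧
        ∀ x, P.d (σ' x) - σ' (P.d x) = w • σ x := by
    intro k σ hσ hwσ
    have hodd : Odd (2 * (k : ℤ) + 1) := ⟨k, rfl⟩
    have hψ : IsDegreeMap P P (2 * (k : ℤ) + 1) (Algebra.lsmul Q Q P w ∘ₗ σ) := by
      refine ⟨fun i x hx => ?_, fun j a ha x => ?_⟩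
      · have := P.smul_mem _ _ w hw _ (hσ.1 i x hx)
        rwa [show 1 + (i + 2 * (k : ℤ)) = i + (2 * k + 1) by ring] at this
      · simp only [LinearMap.comp_apply, Algebra.lsmul_coe]
        rw [hσ.map_smul_of_even (even_two_mul _), ← mul_smul, A.graded_comm 1 j w hw a ha, one_mul,
          add_mul, Int.negOnePow_add, mul_assoc, Int.negOnePow_two_mul, one_mul, one_mul]
        simp only [Units.smul_def, smul_assoc, mul_smul]
    have hcyc : ∀ x, w • σ (P.d x) = -P.d (w • σ x) := by
      intro x
      rw [P.leibniz 1 w hw, hdw, zero_smul, zero_add, Int.negOnePow_one, Units.neg_smul, one_smul,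
        neg_neg, hwσ]
    have hzero : ∀ x, γ.map (w • σ x) = 0 := fun x => by
      rw [γ.isDegreeMap.map_smul_of_even Even.zero, hwY]
    obtain ⟨σ', h1, h2⟩ := hP.exists_boundary s hs γ hγ hγ' _ hodd _ hψ hcyc hzero
    refine ⟨σ', ?_, h2⟩
    rwa [show 2 * (k : ℤ) + 1 + 1 = 2 * (k + 1 : ℕ) by push_cast; ring] at h1
  choose next hdeg hnext using step
  let good : ℕ → Type u := fun k => {σ : Module.End Q P //
    IsDegreeMap P P (2 * k) σ ∧ ∀ x, w • P.d (σ x) = w • σ (P.d x)}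
  let seq : ∀ k, good k := fun k => Nat.rec
    ⟨1, ⟨fun i x hx => by simpa using hx, fun j a _ x => by simp⟩, fun x => rfl⟩
    -- The invariant persists: w[∂, σ_{k+1}] = w² σ_k = 0.
    (fun k σ => ⟨next k σ.1 σ.2.1 σ.2.2, hdeg k σ.1 σ.2.1 σ.2.2, fun x => by
      rw [← sub_eq_zero, ← smul_sub, hnext, ← mul_smul, hww, zero_smul]⟩) k
  exact ⟨fun k => (seq k).1, rfl, fun k => (seq k).2.1,
    fun k x => hnext k (seq k).1 (seq k).2.1 (seq k).2.2 x⟩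

end DGModule

/-! ### Local nilpotence of the variables on the graded dual -/

section Polynomial

variable {Q : Type u} [CommRing Q] (I : Ideal Q) (n : ℕ)

theorem polyGrading_pos (i : ℤ) (hi : 0 < i) : polyGrading I n i = ⊥ := by
  rw [eq_bot_iff]
  intro p hp
  rw [Submodule.mem_bot]
  ext m
  by_contra hm
  have h := (hp : MvPolynomial.IsWeightedHomogeneous _ p i) hm
  rw [Finsupp.weight_apply, Finsupp.sum] at h
  have : ∑ a ∈ m.support, m a • (-2 : ℤ) ≤ 0 := Finset.sum_nonpos fun a _ => by simp
  omega

/-- A functional of degree j sees only the piece of P in degree -j, and P vanishes in positive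
degrees. This lower bound on D is the source of all local finiteness, since χ_i lowers degrees by 2.
-/
theorem dualDG_gr_neg (j : ℤ) (hj : j < 0) : (dualDG I n).gr j = ⊥ := by
  rw [eq_bot_iff]
  intro φ hφ
  refine Subtype.ext (LinearMap.ext fun p => ?_)
  have hp : p ∈ ⨆ i, polyGrading I n i := by
    rw [(isInternal_polyGrading I n).submodule_iSup_eq_top]; trivial
  change φ.1 p = 0
  induction hp using Submodule.iSup_induction' with
  | zero => rw [map_zero]
  | add a b _ _ ha hb => rw [map_add, ha, hb, add_zero]
  | mem i p hp =>
    by_cases h : i = -j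
    · rw [polyGrading_pos I n i (by omega), Submodule.mem_bot] at hp
      rw [hp, map_zero]
    · exact hφ i h p hp

theorem chi_pow_mem (i : Fin n) (k : ℕ) : chi I n i ^ k ∈ (polyDG I n).gr (-2 * k) := by
  induction k with
  | zero => simpa using (polyDG I n).one_mem
  | succ k ih =>
    have := (polyDG I n).mul_mem _ _ _ ih _ (chi_mem I n i)
    rw [pow_succ]
    convert this using 2
    push_cast; ring

/-- Every element of `D` is killed by a power of `χ_i`. -/
theorem exists_chi_pow_smul_eq_zero (i : Fin n) (φ : dualDG I n) :
    ∃ N, (Algebra.lsmul Q Q (dualDG I n) (chi I n i) ^ N) φ = 0 := by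
  induction (dualDG I n).mem_iSup_gr φ using Submodule.iSup_induction' with
  | zero => exact ⟨0, map_zero _⟩
  | add a b _ _ ha hb =>
    obtain ⟨m, hm⟩ := ha
    obtain ⟨m', hm'⟩ := hb
    refine ⟨m + m', ?_⟩
    rw [map_add, pow_add, Module.End.mul_apply, Module.End.mul_apply, hm', map_zero, add_zero,
      ← Module.End.mul_apply, ← pow_add, add_comm, pow_add, Module.End.mul_apply, hm, map_zero]
  | mem j φ hφ =>
    -- Any exponent N with j - 2N < 0 would do.
    refine ⟨j.toNat + 1, ?_⟩
    have := (dualDG I n).smul_mem _ _ _ (chi_pow_mem I n i (j.toNat + 1)) φ hφ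
    rw [dualDG_gr_neg I n _ (by push_cast; omega), Submodule.mem_bot] at this
    rw [← map_pow]
    exact this

end Polynomial

/-! ### Changing one term of the perturbation -/

section Perturbation

variable {Q : Type u} [CommRing Q] {I : Ideal Q} {n : ℕ} {A : DGAlgebra Q}

/-- A scalar from I moves across the tensor product to D, an R-module. This is what makes the
correction terms x_{i,j} ζ_{i,j} invisible on D ⊗ F. -/
theorem tmul_smul_dualDG_eq_zero {X : Type u} [AddCommGroup X] [Module Q X] (q : Q) (hq : q ∈ I)
    (ψ : dualDG I n) (x : X) : ψ ⊗ₜ[Q] (q • x) = 0 := by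
  rw [← TensorProduct.smul_tmul, dualDG_smul_eq_zero I n q hq, TensorProduct.zero_tmul]

theorem chiSum_tmul (X : DGModule A) (a : Fin n → A) (ψ : dualDG I n) (x : X) :
    chiSum I n X a (ψ ⊗ₜ x) = ∑ i, (chi I n i • ψ) ⊗ₜ[Q] (a i • x) := by
  simp only [chiSum, LinearMap.sum_apply, TensorProduct.map_tmul, Algebra.lsmul_coe]

theorem chi_pow_smul_comm (i : Fin n) (k : ℕ) (p : polyDG I n) (ψ : dualDG I n) :
    chi I n i ^ k • p • ψ = p • chi I n i ^ k • ψ := by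
  rw [← mul_smul, ← mul_smul, show chi I n i ^ k * p = p * chi I n i ^ k from
    mul_comm (G := MvPolynomial (Fin n) (Q ⧸ I)) _ _]

/-- If `a` and `b` differ only at `i`, and `a_i - b_i` acts on `D ⊗ X` as an endomorphism `w`
of `X` for which there are `σ_k ∈ Hom_A(X, X)_{2k}` with `σ_0 = 1` and `[∂, σ_{k+1}] = w σ_k`, then `∑ χ_iᵏ ⊗ σ_k`
is an isomorphism between the perturbations by `∑ χ_j ⊗ a_j` and `∑ χ_j ⊗ b_j`. -/
theorem nonempty_iso_perturbedDual_of_eq_off (X : DGModule A) (i : Fin n)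
    (a b : Fin n → A) (hab : ∀ j, j ≠ i → a j = b j) (w : Module.End Q X)
    (hw : ∀ (ψ : dualDG I n) (x : X),
      ψ ⊗ₜ[Q] (a i • x) - ψ ⊗ₜ[Q] (b i • x) = ψ ⊗ₜ[Q] w x)
    (σ : ℕ → Module.End Q X) (h0 : σ 0 = 1)
    (hσ : ∀ k : ℕ, DGModule.IsDegreeMap X X (2 * k) (σ k))
    (hd : ∀ k x, X.d (σ (k + 1) x) - σ (k + 1) (X.d x) = w (σ k x))
    (q : Fin n → Q) (hq : ∀ i, q i ∈ I) (h1 : ∀ i, a i ∈ A.gr 1)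
    (h2 : ∀ i, a i * a i = 0) (h3 : ∀ i, A.d (a i) = algebraMap Q A (q i))
    (q' : Fin n → Q) (hq' : ∀ i, q' i ∈ I) (h1' : ∀ i, b i ∈ A.gr 1)
    (h2' : ∀ i, b i * b i = 0) (h3' : ∀ i, A.d (b i) = algebraMap Q A (q' i)) :
    Nonempty (DGModule.Iso (perturbedDual I n X a q hq h1 h2 h3)
      (perturbedDual I n X b q' hq' h1' h2' h3')) := by
  let p := Algebra.lsmul Q Q (dualDG I n) (chi I n i)
  let u : ℕ → Module.End Q (dualDG I n ⊗[Q] X) := fun k => TensorProduct.map (p ^ k) (σ k)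
  have hu : ∀ (k : ℕ) (ψ : dualDG I n) (x : X),
      u k (ψ ⊗ₜ x) = (chi I n i ^ k • ψ) ⊗ₜ[Q] σ k x := by
    intro k ψ x
    change (p ^ k) ψ ⊗ₜ[Q] σ k x = _
    rw [← map_pow]
    rfl
  have hlin : ∀ k (c : A) (x : X), σ k (c • x) = c • σ k x := fun k c x =>
    (hσ k).map_smul_of_even (even_two_mul _) c x
  have hloc := exists_vanish_tensorSeries p (exists_chi_pow_smul_eq_zero I n i) σ
  let Φ : Module.End Q (dualDG I n ⊗[Q] X) := tensorSeries p (exists_chi_pow_smul_eq_zero I n i) σ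
  have hΦnil : ∀ z, ∃ m : ℕ, ((1 - Φ) ^ m) z = 0 := tensorSeries_locallyNilpotent p _ σ h0
  -- The factor χ_i^k lowers degrees by 2k and σ_k raises them by 2k.
  have hΦgr : ∀ (j : ℤ) z, z ∈ tensorGrading (dualDG I n).gr X.gr j →
      Φ z ∈ tensorGrading (dualDG I n).gr X.gr j := by
    intro j z hz
    refine locallyFiniteSum_mem u hloc z _ fun k => ?_
    induction hz using Submodule.span_induction with
    | zero => rw [map_zero]; exact zero_mem _
    | add y z _ _ h h' => rw [map_add]; exact add_mem h h'
    | smul r z _ h => rw [map_smul]; exact Submodule.smul_mem _ _ h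
    | mem z hz =>
      obtain ⟨i₁, i₂, rfl, ψ, hψ, x, hx, rfl⟩ := hz
      rw [hu]
      exact Submodule.subset_span ⟨-2 * k + i₁, i₂ + 2 * k, by ring, _,
        (dualDG I n).smul_mem _ _ _ (chi_pow_mem I n i k) ψ hψ, _, (hσ k).1 _ x hx, rfl⟩
  -- Powers of χ_i commute with P, and each σ_k is A-linear without sign because its degree is even.
  have hact : ∀ (r : polyDG I n ⊗[Q] A) z,
      Φ ((dualDG I n).tensorAction X r z) = (dualDG I n).tensorAction X r (Φ z) := by
    intro r z
    refine locallyFiniteSum_comm u hloc _ (fun k z => ?_) z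
    induction r with
    | zero => simp
    | add r r' h h' => simp only [map_add, LinearMap.add_apply, h, h']
    | tmul s c =>
      induction z with
      | zero => simp
      | add z z' h h' => simp only [map_add, h, h']
      | tmul ψ x =>
        rw [hu, DGModule.tensorAction_tmul, DGModule.tensorAction_tmul, hu, hlin,
          chi_pow_smul_comm]
  let D : Module.End Q (dualDG I n ⊗[Q] X) := X.d.lTensor (dualDG I n)
  -- The difference of the two perturbations, which reduces to χ_i ⊗ w because all other terms
  -- agree.
  let C : Module.End Q (dualDG I n ⊗[Q] X) := chiSum I n X a - chiSum I n X b
  have hC : ∀ (ψ : dualDG I n) (x : X),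
      C (ψ ⊗ₜ x) = (chi I n i • ψ) ⊗ₜ[Q] w x := by
    intro ψ x
    rw [LinearMap.sub_apply, chiSum_tmul, chiSum_tmul, ← Finset.sum_sub_distrib,
      Finset.sum_eq_single i]
    · exact hw _ x
    · intro j _ hj
      rw [hab j hj, sub_self]
    · exact fun h => absurd (Finset.mem_univ i) h
  have hcomm : ∀ z, D (Φ z) = Φ (D z) + C (Φ z) := by
    refine locallyFiniteSum_commutator u hloc D C (fun z => ?_) (fun k z => ?_)
    · have : u 0 = 1 := by
        change TensorProduct.map (p ^ 0) (σ 0) = 1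
        rw [h0, pow_zero]
        exact TensorProduct.map_one
      rw [this]
      rfl
    · induction z with
      | zero => simp
      | add z z' h h' =>
        simp only [map_add]
        rw [← h, ← h']
        abel
      | tmul ψ x =>
        have hD : ∀ (ψ : dualDG I n) (x : X), D (ψ ⊗ₜ x) = ψ ⊗ₜ X.d x := fun _ _ => rfl
        rw [hu, hD, hD, hu, hu, hC, ← TensorProduct.tmul_sub, ← mul_smul, ← pow_succ']
        exact congrArg _ (hd k x)
  refine DGModule.Hom.nonempty_iso ⟨Φ, ⟨fun j z hz => ?_, fun j r hr z => ?_⟩, fun z => ?_⟩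
    (injective_of_locallyNilpotent Φ hΦnil)
    (fun j z hz => exists_mem_eq_of_locallyNilpotent Φ hΦnil _ (hΦgr j) z hz)
  · rw [add_zero]
    exact hΦgr j z hz
  · rw [zero_mul, Int.negOnePow_zero, one_smul]
    exact hact r z
  · change Φ (D z + chiSum I n X a z) = D (Φ z) + chiSum I n X b (Φ z)
    have : Φ (chiSum I n X a z) = chiSum I n X a (Φ z) := by
      rw [chiSum_eq]
      exact hact _ z
    have h : D (Φ z) = Φ (D z) + C (Φ z) := hcomm z
    rw [LinearMap.sub_apply] at h
    exact (map_add Φ _ _).trans (by rw [this, h, add_assoc, sub_add_cancel])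

/-- If each `a_i - b_i` acts on `D ⊗ X` as an endomorphism `w_i` of `X` for which there are
`σ_{i,k} ∈ Hom_A(X, X)_{2k}` with `σ_{i,0} = 1` and `[∂, σ_{i,k+1}] = w_i σ_{i,k}`, then the
perturbations by `∑ χ_i ⊗ a_i` and `∑ χ_i ⊗ b_i` are isomorphic. -/
theorem nonempty_iso_perturbedDual (X : DGModule A)
    (a b : Fin n → A) (w : Fin n → Module.End Q X)
    (hw : ∀ (i : Fin n) (ψ : dualDG I n) (x : X),
      ψ ⊗ₜ[Q] (a i • x) - ψ ⊗ₜ[Q] (b i • x) = ψ ⊗ₜ[Q] w i x)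
    (hσ : ∀ i, ∃ σ : ℕ → Module.End Q X, σ 0 = 1 ∧
      (∀ k : ℕ, DGModule.IsDegreeMap X X (2 * k) (σ k)) ∧
      ∀ k x, X.d (σ (k + 1) x) - σ (k + 1) (X.d x) = w i (σ k x))
    (q : Fin n → Q) (hq : ∀ i, q i ∈ I) (h1 : ∀ i, a i ∈ A.gr 1)
    (h2 : ∀ i, a i * a i = 0) (h3 : ∀ i, A.d (a i) = algebraMap Q A (q i))
    (q' : Fin n → Q) (hq' : ∀ i, q' i ∈ I) (h1' : ∀ i, b i ∈ A.gr 1)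
    (h2' : ∀ i, b i * b i = 0) (h3' : ∀ i, A.d (b i) = algebraMap Q A (q' i)) :
    Nonempty (DGModule.Iso (perturbedDual I n X a q hq h1 h2 h3)
      (perturbedDual I n X b q' hq' h1' h2' h3')) := by
  -- Induction on the set s of indices at which a has already been replaced by b, with c the
  -- resulting mixed family.
  have key : ∀ (s : Finset (Fin n)) (c : Fin n → A) (r : Fin n → Q) (hr : ∀ i, r i ∈ I)
      (h1c : ∀ i, c i ∈ A.gr 1) (h2c : ∀ i, c i * c i = 0)
      (h3c : ∀ i, A.d (c i) = algebraMap Q A (r i)),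
      (∀ i ∈ s, c i = b i) → (∀ i, i ∉ s → c i = a i) →
      Nonempty (DGModule.Iso (perturbedDual I n X a q hq h1 h2 h3)
        (perturbedDual I n X c r hr h1c h2c h3c)) := by
    intro s
    induction s using Finset.induction_on with
    | empty =>
      intro c r hr h1c h2c h3c _ hca
      obtain rfl : c = a := funext fun i => hca i (Finset.notMem_empty i)
      -- The boundaries r and q enter the perturbed module only through proofs, so they need not be
      -- identified.
      exact ⟨DGModule.Iso.refl _⟩
    | insert i s hi ih =>
      intro c r hr h1c h2c h3c hcb hca
      have hne : ∀ j, j ≠ i → Function.update c i (a i) j = c j := fun j hj =>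
        Function.update_of_ne hj _ _
      have hupd : ∀ j, (Function.update c i (a i) j = c j ∧ Function.update r i (q i) j = r j) ∨
          (Function.update c i (a i) j = a j ∧ Function.update r i (q i) j = q j) := by
        intro j
        by_cases hj : j = i
        · subst hj
          exact Or.inr ⟨Function.update_self _ _ _, Function.update_self _ _ _⟩
        · exact Or.inl ⟨Function.update_of_ne hj _ _, Function.update_of_ne hj _ _⟩
      -- Resetting the entry at i to a_i gives the mixed family for s, which differs from c only at
      -- i.
      obtain ⟨e⟩ := ih (Function.update c i (a i)) (Function.update r i (q i))
        (fun j => by rcases hupd j with h | h <;> rw [h.2]; exacts [hr j, hq j])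
        (fun j => by rcases hupd j with h | h <;> rw [h.1]; exacts [h1c j, h1 j])
        (fun j => by rcases hupd j with h | h <;> rw [h.1]; exacts [h2c j, h2 j])
        (fun j => by rcases hupd j with h | h <;> rw [h.1, h.2]; exacts [h3c j, h3 j])
        (fun j hj => by
          rw [hne j (fun h => hi (h ▸ hj))]
          exact hcb j (Finset.mem_insert_of_mem hj))
        (fun j hj => by
          by_cases hji : j = i
          · subst hji
            exact Function.update_self _ _ _
          · rw [hne j hji]
            exact hca j (by simp [hji, hj]))
      obtain ⟨σ, h0, hdeg, hd⟩ := hσ i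
      obtain ⟨e'⟩ := nonempty_iso_perturbedDual_of_eq_off (I := I) X i
        (Function.update c i (a i)) c hne (w i)
        (fun ψ x => by
          rw [Function.update_self, hcb i (Finset.mem_insert_self i s)]
          exact hw i ψ x) σ h0 hdeg hd _ _ _ _ _ r hr h1c h2c h3c
      exact ⟨e.trans e'⟩
  exact key Finset.univ b q' hq' h1' h2' h3' (fun _ _ => rfl)
    (fun i hi => absurd (Finset.mem_univ i) hi)

/-- The same for the restriction of scalars of a DG `B`-module along `A → B`, with `w_i ∈ B` and
`σ_{i,k} ∈ Hom_B(F, F)_{2k}`. -/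
theorem nonempty_iso_perturbedDual_restrictScalars {B : DGAlgebra Q} (θ : DGAlgebra.Hom A B)
    (F : DGModule B) (a b : Fin n → A) (w : Fin n → B)
    (hw : ∀ (i : Fin n) (ψ : dualDG I n) (x : F),
      ψ ⊗ₜ[Q] (θ.map (a i) • x) - ψ ⊗ₜ[Q] (θ.map (b i) • x) = ψ ⊗ₜ[Q] (w i • x))
    (hσ : ∀ i, ∃ σ : ℕ → Module.End Q F, σ 0 = 1 ∧
      (∀ k : ℕ, DGModule.IsDegreeMap F F (2 * k) (σ k)) ∧
      ∀ k x, F.d (σ (k + 1) x) - σ (k + 1) (F.d x) = w i • σ k x)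
    (q : Fin n → Q) (hq : ∀ i, q i ∈ I) (h1 : ∀ i, a i ∈ A.gr 1)
    (h2 : ∀ i, a i * a i = 0) (h3 : ∀ i, A.d (a i) = algebraMap Q A (q i))
    (q' : Fin n → Q) (hq' : ∀ i, q' i ∈ I) (h1' : ∀ i, b i ∈ A.gr 1)
    (h2' : ∀ i, b i * b i = 0) (h3' : ∀ i, A.d (b i) = algebraMap Q A (q' i)) :
    Nonempty (DGModule.Iso (perturbedDual I n (F.restrictScalars θ) a q hq h1 h2 h3)
      (perturbedDual I n (F.restrictScalars θ) b q' hq' h1' h2' h3')) := by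
  refine nonempty_iso_perturbedDual (F.restrictScalars θ) a b
    (fun i => Algebra.lsmul Q Q F (w i)) hw (fun i => ?_) q hq h1 h2 h3 q' hq' h1' h2' h3'
  obtain ⟨σ, h0, hdeg, hd⟩ := hσ i
  -- Restriction of scalars keeps the underlying complex, so the homotopy relations carry over even
  -- though w_i need not come from A.
  exact ⟨σ, h0, fun k => (hdeg k).restrictScalars θ, hd⟩

end Perturbation

/-! ### The cycles `ξ_i - ξ'_i - ∑_j x_{i,j} ζ_{i,j}` -/

section Koszul

variable {Q : Type u} [CommRing Q] {κ : Type}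

/-- The automorphism `a ↦ (-1)^{|a|} a` of a Koszul complex. -/
noncomputable def koszulInvolute (h : κ → Q) : koszul h →ₐ[Q] koszul h :=
  (ExteriorAlgebra.map (-LinearMap.id) :
    ExteriorAlgebra Q (κ →₀ Q) →ₐ[Q] ExteriorAlgebra Q (κ →₀ Q))

theorem koszulInvolute_apply (h : κ → Q) (i : ℤ) (a : koszul h) (ha : a ∈ (koszul h).gr i) :
    koszulInvolute h a = i.negOnePow • a := by
  rcases i with k | k
  · refine exteriorGrading_induction (C := fun (k : ℕ) x =>
      (ExteriorAlgebra.map (-LinearMap.id) :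
        ExteriorAlgebra Q (κ →₀ Q) →ₐ[Q] ExteriorAlgebra Q (κ →₀ Q)) x =
          (k : ℤ).negOnePow • x) ?_ ?_ ?_ k a ha
    · intro r
      simp
    · intro k x y hx hy
      rw [map_add, hx, hy, smul_add]
    · intro k v x _ ih
      rw [map_mul, ih, ExteriorAlgebra.map_apply_ι, Nat.cast_add, Nat.cast_one,
        Int.negOnePow_succ, LinearMap.neg_apply, LinearMap.id_apply, map_neg, neg_mul,
        mul_smul_comm, Units.neg_smul]
  · rw [show a = 0 from ha, map_zero, smul_zero]

theorem koszulInl_gen {μ : Type} (h : κ → Q) (g : μ → Q) (i : κ) :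
    (koszulInl h g).map (koszulGen h i) = koszulGen (Sum.elim h g) (Sum.inl i) := by
  refine (ExteriorAlgebra.map_apply_ι _ _).trans ?_
  rw [Finsupp.lmapDomain_apply, Finsupp.mapDomain_single]
  rfl

/-- Graded commutativity gives only 2a² = 0; the vanishing of a² itself comes from the exterior
algebra, whose degree 1 part consists of vectors. -/
theorem koszul_mul_self_eq_zero (h : κ → Q) (a : koszul h) (ha : a ∈ (koszul h).gr 1) :
    a * a = 0 := by
  have ha' : a ∈ (LinearMap.range (ExteriorAlgebra.ι Q : (κ →₀ Q) →ₗ[Q] _)) ^ 1 := ha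
  rw [pow_one] at ha'
  obtain ⟨v, rfl⟩ := ha'
  exact ExteriorAlgebra.ι_sq_zero v

/-- The action on M factors through the augmentation, which vanishes in positive degrees. -/
theorem koszulModule_smul_eq_zero (h : κ → Q) (M : Type u) [AddCommGroup M] [Module Q M]
    (hM : ∀ i, h i ∈ Module.annihilator Q M) (a : koszul h) (ha : a ∈ (koszul h).gr 1)
    (y : koszulModule h M hM) : a • y = 0 := by
  have : a • y = ((0 : Q) • (show M from y) : M) :=
    congrArg (fun r : Q => r • (show M from y)) (algebraMapInv_eq_zero 0 a ha)
  rw [this]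
  exact zero_smul Q (show M from y)

end Koszul

namespace StrongResolution

variable {Q : Type u} [CommRing Q] {n : ℕ} {I : Ideal Q} {f f' : Fin n → Q} {hf : ∀ i, f i ∈ I}
  {hf' : ∀ i, f' i ∈ I} {M : Type u} [AddCommGroup M] [Module Q M] [Module (Q ⧸ I) M]
  [IsScalarTower Q (Q ⧸ I) M] (S : StrongResolution I f f' hf hf' M)

/-- The generators of `B`. -/
noncomputable abbrev gen (k : (Fin n ⊕ Fin n) ⊕ (Σ i, Fin (S.m i))) : BAlg f f' S.g :=
  koszulGen (Sum.elim (Sum.elim f f') (fun p : Σ i, Fin (S.m i) => S.g p.1 p.2)) k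

/-- The element `ξ_i - ξ'_i - ∑_j x_{i,j} ζ_{i,j}` of `B`. -/
noncomputable def cycle (i : Fin n) : BAlg f f' S.g :=
  S.gen (Sum.inl (Sum.inl i)) - S.gen (Sum.inl (Sum.inr i)) -
    ∑ j, S.x i j • S.gen (Sum.inr ⟨i, j⟩)

theorem cycle_mem (i : Fin n) : S.cycle i ∈ (BAlg f f' S.g).gr 1 :=
  sub_mem (sub_mem (koszulGen_mem _ _) (koszulGen_mem _ _))
    (Submodule.sum_mem _ fun _ _ => Submodule.smul_mem _ _ (koszulGen_mem _ _))

theorem cycle_d (i : Fin n) : (BAlg f f' S.g).d (S.cycle i) = 0 := by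
  simp only [cycle, map_sub, map_sum, map_smul, koszulGen_d, Sum.elim_inl, Sum.elim_inr]
  simp only [Algebra.smul_def, ← map_mul, ← map_sum, ← map_sub]
  rw [← S.sum_eq i, sub_self, map_zero]

/-- The two sides differ by the terms x_{i,j} ζ_{i,j}, which die against D because x_{i,j} ∈ I. Thus
ξ_i - ξ'_i, in general not a cycle, may be replaced by the cycle w_i. -/
theorem tmul_cycle_smul (i : Fin n) (ψ : dualDG I n) (x : S.F) :
    ψ ⊗ₜ[Q] ((lamToB f f' S.g).map (xi f f' i) • x) -
      ψ ⊗ₜ[Q] ((lamToB f f' S.g).map (xi' f f' i) • x) = ψ ⊗ₜ[Q] (S.cycle i • x) := by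
  have hz : ψ ⊗ₜ[Q] ((∑ j, S.x i j • S.gen (Sum.inr ⟨i, j⟩)) • x) = 0 := by
    rw [Finset.sum_smul, TensorProduct.tmul_sum]
    refine Finset.sum_eq_zero fun j _ => ?_
    rw [smul_assoc, tmul_smul_dualDG_eq_zero _ (S.x_mem i j)]
  rw [koszulInl_gen, koszulInl_gen, cycle, sub_smul _ (∑ j, _), TensorProduct.tmul_sub, hz,
    sub_zero, sub_smul, TensorProduct.tmul_sub]

theorem exists_homotopies (i : Fin n) :
    ∃ σ : ℕ → Module.End Q S.F, σ 0 = 1 ∧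
      (∀ k : ℕ, DGModule.IsDegreeMap S.F S.F (2 * k) (σ k)) ∧
      ∀ k x, S.F.d (σ (k + 1) x) - σ (k + 1) (S.F.d x) = S.cycle i • σ k x :=
  S.semiprojective.exists_homotopies (koszulInvolute _) (koszulInvolute_apply _) S.aug
    S.aug_surjective S.aug_quasiIso (S.cycle i) (S.cycle_mem i)
    (koszul_mul_self_eq_zero _ _ (S.cycle_mem i)) (S.cycle_d i)
    (koszulModule_smul_eq_zero _ M _ _ (S.cycle_mem i))

end StrongResolution

theorem lemma5 {Q : Type u} [CommRing Q] {n : ℕ} (f f' : Fin n → Q) (I : Ideal Q)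
    (hf : ∀ i, f i ∈ I) (hf' : ∀ i, f' i ∈ I)
    (M : Type u) [AddCommGroup M] [Module Q M] [Module (Q ⧸ I) M] [IsScalarTower Q (Q ⧸ I) M]
    (hM : ∀ i, f i - f' i ∈ I * Module.annihilator Q M)
    (S : StrongResolution I f f' hf hf' M) :
    Nonempty (DGModule.Iso S.perturbDelta S.perturbEpsilon) := by
  -- Cycles and homotopies live over `B`, where F is semiprojective; the perturbations and the
  -- isomorphism are formed over Λ.
  exact nonempty_iso_perturbedDual_restrictScalars (lamToB f f' S.g) S.F _ _ S.cycle
    S.tmul_cycle_smul S.exists_homotopies _ _ _ _ _ _ _ _ _ _
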